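/- Let $\mathfrak g\subset\mathfrak{gl}(n,\mathbb R)$ be a real semisimple Lie algebra with complexification $\mathfrak g^{\mathbb C}=\mathfrak g+\sqrt{-1}\,\mathfrak g\subset\mathfrak{gl}(n,\mathbb C)$ and conjugation $\sigma(X+\sqrt{-1}Y)=X-\sqrt{-1}Y$. Let $\mathfrak c$ be a Cartan subalgebra of $\mathfrak g$, that is, a maximal abelian subalgebra whose adjoint action on $\mathfrak g^{\mathbb C}$ is diagonalizable. Let $R^+$ be a positive system of roots of $\mathfrak c^{\mathbb C}$ in $\mathfrak g^{\mathbb C}$, and let $\mathfrak y=\sum_{\alpha\in R^+}(\mathfrak g^{\mathbb C})_\alpha$. For a simple root $\beta$ choose root vectors $X_\beta\in(\mathfrak g^{\mathbb C})_\beta$, $X_{-\beta}\in(\mathfrak g^{\mathbb C})_{-\beta}$ and $H_\beta\in\mathfrak c^{\mathbb C}$ with $[X_\beta,X_{-\beta}]=H_\beta$, $[H_\beta,X_{\pm\beta}]=\pm2X_{\pm\beta}$, and put $w_\beta=\exp(X_\beta)\exp(-X_{-\beta})\exp(X_\beta)$. Let $\beta_1,\dots,\beta_l$ be simple roots such that $\omega=w_{\beta_1}\cdots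 w_{\beta_l}$ satisfies $\omega\mathfrak y\omega^{-1}=\sigma(\mathfrak y)$; then $\omega$ normalizes $\mathfrak c^{\mathbb C}$. For a complex linear form $\lambda$ on $\mathfrak c^{\mathbb C}$ put $\lambda^\sigma(H)=\overline{\lambda(\sigma(H))}$ and $(\omega^{-1}\lambda^\sigma)(H)=\lambda^\sigma(\omega H\omega^{-1})$. Let $\rho:\mathfrak g\to\mathfrak{gl}(V)$ be a representation on a finite-dimensional real vector space $V$, and extend it complex linearly to $\rho:\mathfrak g^{\mathbb C}\to\mathfrak{gl}(V^{\mathbb C})$, $V^{\mathbb C}=V\otimes_{\mathbb R}\mathbb C$. Write $v\mapsto\overline v$ for the conjugation of $V^{\mathbb C}$, and $\omega_\rho=w_{\beta_1,\rho}\cdots w_{\beta_l,\rho}$ with $w_{\beta,\rho}=\exp(\rho(X_\beta))\exp(-\rho(X_{-\beta}))\exp(\rho(X_\beta))$. A high weight vector of weight $\lambda$ is a nonzero $v\in V^{\mathbb C}$ with $\rho(\mathfrak y)v=0$ and $\rho(H)v=\lambda(H)v$ for all $H\in\mathfrak c^{\mathbb C}$. The isotypical component $V^{\mathbb C}(\lambda)$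 is the $\mathfrak g^{\mathbb C}$-invariant subspace of $V^{\mathbb C}$ generated by the high weight vectors of weight $\lambda$. Suppose that $\lambda=\omega^{-1}\lambda^\sigma$, and let $M$ be a $\mathfrak g^{\mathbb C}$-invariant and conjugation invariant proper subspace of $V^{\mathbb C}(\lambda)$. Then: 1. $M$ has a $\mathfrak g^{\mathbb C}$-invariant and conjugation invariant complement in $V^{\mathbb C}(\lambda)$. 2. Let $w_1,\dots,w_d$ be a basis of high weight vectors of $M$, i.e. linearly independent high weight vectors in $M$ whose span contains every high weight vector in $M$. Then there is a high weight vector $v$ of weight $\lambda$ such that - either $w_1\wedge\cdots\wedge w_d\wedge v\neq0$ and $v\wedge\omega_\rho^{-1}\overline v=0$, - or $v\wedge\omega_\rho^{-1}\overline v\neq0$ and $w_1\wedge\cdots\wedge w_d\wedge v\wedge\omega_\rho^{-1}\overline v\neq0$. -/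

import Mathlib

open scoped TensorProduct

attribute [local instance 100] LieRing.ofAssociativeRing

noncomputable section

namespace RealRep

/-! ### Complexification of a real matrix Lie algebra -/

theorem map_re_lie {n : ℕ} (A B : Matrix (Fin n) (Fin n) ℂ) :
    (⁅A, B⁆ : Matrix (Fin n) (Fin n) ℂ).map Complex.re =
      ⁅A.map Complex.re, B.map Complex.re⁆ - ⁅A.map Complex.im, B.map Complex.im⁆ := by
  ext i j
  simp only [LieRing.of_associative_ring_bracket, Matrix.map_apply, Matrix.sub_apply,
    Matrix.mul_apply, Complex.sub_re, Complex.re_sum, Complex.mul_re, Finset.sum_sub_distrib]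
  ring

theorem map_im_lie {n : ℕ} (A B : Matrix (Fin n) (Fin n) ℂ) :
    (⁅A, B⁆ : Matrix (Fin n) (Fin n) ℂ).map Complex.im =
      ⁅A.map Complex.re, B.map Complex.im⁆ + ⁅A.map Complex.im, B.map Complex.re⁆ := by
  ext i j
  simp only [LieRing.of_associative_ring_bracket, Matrix.map_apply, Matrix.sub_apply,
    Matrix.add_apply, Matrix.mul_apply, Complex.sub_im, Complex.im_sum, Complex.mul_im,
    Finset.sum_add_distrib]
  ring

/-- The complexification `𝔤 + i𝔤` of a real matrix Lie algebra `𝔤`: the complex matrices whose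
real part and imaginary part both lie in `𝔤`. -/
def complexify {n : ℕ} (g : LieSubalgebra ℝ (Matrix (Fin n) (Fin n) ℝ)) :
    LieSubalgebra ℂ (Matrix (Fin n) (Fin n) ℂ) where
  carrier := {Z | Z.map Complex.re ∈ g ∧ Z.map Complex.im ∈ g}
  add_mem' := by
    rintro A B ⟨hA, hA'⟩ ⟨hB, hB'⟩
    refine ⟨?_, ?_⟩
    · have : (A + B).map Complex.re = A.map Complex.re + B.map Complex.re := by ext; simp
      rw [this]; exact g.add_mem hA hB
    · have : (A + B).map Complex.im = A.map Complex.im + B.map Complex.im := by ext; simp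
      rw [this]; exact g.add_mem hA' hB'
  zero_mem' := by
    refine ⟨?_, ?_⟩
    · have : (0 : Matrix (Fin n) (Fin n) ℂ).map Complex.re = 0 := by ext; simp
      rw [this]; exact g.zero_mem
    · have : (0 : Matrix (Fin n) (Fin n) ℂ).map Complex.im = 0 := by ext; simp
      rw [this]; exact g.zero_mem
  smul_mem' := by
    rintro z A ⟨hA, hA'⟩
    refine ⟨?_, ?_⟩
    · have : (z • A).map Complex.re = z.re • A.map Complex.re - z.im • A.map Complex.im := by
        ext; simp
      rw [this]; exact g.sub_mem (g.smul_mem _ hA) (g.smul_mem _ hA')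
    · have : (z • A).map Complex.im = z.re • A.map Complex.im + z.im • A.map Complex.re := by
        ext; simp
      rw [this]; exact g.add_mem (g.smul_mem _ hA') (g.smul_mem _ hA)
  lie_mem' := by
    rintro A B ⟨hA, hA'⟩ ⟨hB, hB'⟩
    refine ⟨?_, ?_⟩
    · rw [map_re_lie]; exact g.sub_mem (g.lie_mem hA hB) (g.lie_mem hA' hB')
    · rw [map_im_lie]; exact g.add_mem (g.lie_mem hA hB') (g.lie_mem hA' hB)

section

variable {n : ℕ} {g : LieSubalgebra ℝ (Matrix (Fin n) (Fin n) ℝ)}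

/-- The real part `X` of `X + iY`. -/
def rePart : complexify g →ₗ[ℝ] g where
  toFun Z := ⟨(Z : Matrix (Fin n) (Fin n) ℂ).map Complex.re, Z.2.1⟩
  map_add' A B := by ext; simp
  map_smul' r A := by ext; simp

/-- The imaginary part `Y` of `X + iY`. -/
def imPart : complexify g →ₗ[ℝ] g where
  toFun Z := ⟨(Z : Matrix (Fin n) (Fin n) ℂ).map Complex.im, Z.2.2⟩
  map_add' A B := by ext; simp
  map_smul' r A := by ext; simp

/-- The inclusion of `𝔤` in its complexification. -/
def ofReal : g →ₗ[ℝ] complexify g where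
  toFun X := ⟨(X : Matrix (Fin n) (Fin n) ℝ).map Complex.ofReal, by
    refine ⟨?_, ?_⟩
    · have : ((X : Matrix (Fin n) (Fin n) ℝ).map Complex.ofReal).map Complex.re = X := by
        ext; simp
      rw [this]; exact X.2
    · have : ((X : Matrix (Fin n) (Fin n) ℝ).map Complex.ofReal).map Complex.im = 0 := by
        ext; simp
      rw [this]; exact g.zero_mem⟩
  map_add' A B := by ext; simp
  map_smul' r A := by ext; simp

/-- The conjugation `σ : X + iY ↦ X - iY` of the complexification (entrywise conjugation). -/
def conj (Z : complexify g) : complexify g :=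
  ⟨(Z : Matrix (Fin n) (Fin n) ℂ).map (starRingEnd ℂ), by
    refine ⟨?_, ?_⟩
    · have : ((Z : Matrix (Fin n) (Fin n) ℂ).map (starRingEnd ℂ)).map Complex.re =
          (Z : Matrix (Fin n) (Fin n) ℂ).map Complex.re := by ext; simp
      rw [this]; exact Z.2.1
    · have : ((Z : Matrix (Fin n) (Fin n) ℂ).map (starRingEnd ℂ)).map Complex.im =
          -(Z : Matrix (Fin n) (Fin n) ℂ).map Complex.im := by ext; simp
      rw [this]; exact g.neg_mem Z.2.2⟩

theorem rePart_conj (Z : complexify g) : rePart (conj Z) = rePart Z := by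
  ext; simp [rePart, conj]

theorem imPart_conj (Z : complexify g) : imPart (conj Z) = -imPart Z := by
  ext; simp [imPart, conj]

theorem rePart_smul (z : ℂ) (A : complexify g) :
    rePart (z • A) = z.re • rePart A - z.im • imPart A := by
  ext; simp [rePart, imPart]

theorem imPart_smul (z : ℂ) (A : complexify g) :
    imPart (z • A) = z.re • imPart A + z.im • rePart A := by
  ext; simp [rePart, imPart]

theorem rePart_lie (A B : complexify g) :
    rePart ⁅A, B⁆ = ⁅rePart A, rePart B⁆ - ⁅imPart A, imPart B⁆ :=
  Subtype.ext (map_re_lie _ _)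

theorem imPart_lie (A B : complexify g) :
    imPart ⁅A, B⁆ = ⁅rePart A, imPart B⁆ + ⁅imPart A, rePart B⁆ :=
  Subtype.ext (map_im_lie _ _)

/-! ### Cartan subalgebras, roots, positive systems -/

/-- A Cartan subalgebra of the real semisimple Lie algebra `𝔤`: a maximal abelian subalgebra which
is (ad-)diagonalizable in the complexification of `𝔤`. -/
structure IsCartan (c : LieSubalgebra ℝ g) : Prop where
  abelian : IsLieAbelian c
  maximal : ∀ c' : LieSubalgebra ℝ g, c ≤ c' → IsLieAbelian c' → c' = c
  diagonalizable : ∀ x ∈ c,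
    ⨆ μ : ℂ, Module.End.eigenspace
      (LieAlgebra.ad ℂ (complexify g) (ofReal x) : Module.End ℂ (complexify g)) μ = ⊤

/-- The complexification `𝔠 + i𝔠`, as a complex subspace of `𝔤 + i𝔤`. -/
def cartanC (c : LieSubalgebra ℝ g) : Submodule ℂ (complexify g) where
  carrier := {Z | rePart Z ∈ c ∧ imPart Z ∈ c}
  add_mem' := by
    rintro A B ⟨hA, hA'⟩ ⟨hB, hB'⟩
    exact ⟨by rw [map_add]; exact c.add_mem hA hB, by rw [map_add]; exact c.add_mem hA' hB'⟩
  zero_mem' := ⟨by rw [map_zero]; exact c.zero_mem, by rw [map_zero]; exact c.zero_mem⟩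
  smul_mem' := by
    rintro z A ⟨hA, hA'⟩
    refine ⟨?_, ?_⟩
    · rw [rePart_smul]; exact c.sub_mem (c.smul_mem _ hA) (c.smul_mem _ hA')
    · rw [imPart_smul]; exact c.add_mem (c.smul_mem _ hA') (c.smul_mem _ hA)

/-- The space of root vectors (with zero) of a linear form `α` on `𝔠 + i𝔠`. -/
def rootSpace (c : LieSubalgebra ℝ g) (α : Module.Dual ℂ (cartanC c)) :
    Submodule ℂ (complexify g) where
  carrier := {Z | ∀ H : cartanC c, ⁅(H : complexify g), Z⁆ = α H • Z}
  add_mem' := by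
    intro A B hA hB H
    rw [lie_add, hA H, hB H, smul_add]
  zero_mem' := by intro H; simp
  smul_mem' := by
    intro z A hA H
    rw [lie_smul, hA H, smul_comm]

/-- The roots of `𝔠 + i𝔠` in `𝔤 + i𝔤`. -/
def IsRoot (c : LieSubalgebra ℝ g) (α : Module.Dual ℂ (cartanC c)) : Prop :=
  α ≠ 0 ∧ rootSpace c α ≠ ⊥

/-- A positive system of roots: it contains exactly one of `α`, `-α` for every root `α`, and it
contains every root that is a sum of two of its members. -/
structure IsPositiveSystem (c : LieSubalgebra ℝ g) (P : Set (Module.Dual ℂ (cartanC c))) :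
    Prop where
  isRoot : ∀ α ∈ P, IsRoot c α
  mem_xor_neg_mem : ∀ α, IsRoot c α → Xor (α ∈ P) (-α ∈ P)
  add_mem : ∀ α ∈ P, ∀ β ∈ P, IsRoot c (α + β) → α + β ∈ P

/-- A simple root: a positive root that is not a sum of two positive roots. -/
def IsSimpleRoot {c : LieSubalgebra ℝ g} (P : Set (Module.Dual ℂ (cartanC c)))
    (α : Module.Dual ℂ (cartanC c)) : Prop :=
  α ∈ P ∧ ¬ ∃ β ∈ P, ∃ γ ∈ P, α = β + γ

/-- The nilradical `𝔶` of the Borel subalgebra given by a positive system: the sum of the positive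
root spaces. -/
def nilradical {c : LieSubalgebra ℝ g} (P : Set (Module.Dual ℂ (cartanC c))) :
    Submodule ℂ (complexify g) :=
  ⨆ α ∈ P, rootSpace c α

/-! ### Weyl group representatives -/

/-- A standard copy of `𝔰𝔩(2, ℂ)` attached to a simple root `α`: root vectors `X` of `α` and `Y` of
`-α` and `H` in the Cartan subalgebra, with `[X, Y] = H`, `[H, X] = 2X`, `[H, Y] = -2Y`. -/
structure SimpleTriple {c : LieSubalgebra ℝ g} (P : Set (Module.Dual ℂ (cartanC c))) where
  α : Module.Dual ℂ (cartanC c)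
  simple : IsSimpleRoot P α
  X : complexify g
  Y : complexify g
  H : cartanC c
  X_mem : X ∈ rootSpace c α
  Y_mem : Y ∈ rootSpace c (-α)
  isSl2Triple : IsSl2Triple (H : complexify g) X Y

/-- `exp(x) exp(-y) exp(x)`. It is only used for `x`, `y` the images of `X`, `Y` (as in
`SimpleTriple`) in a finite-dimensional representation; these are nilpotent, so that
`IsNilpotent.exp` is the exponential. -/
def weylFactor {A : Type*} [Ring A] [Module ℚ A] (x y : A) : A :=
  IsNilpotent.exp x * IsNilpotent.exp (-y) * IsNilpotent.exp x

/-- The element `ω = w_{β₁} ⋯ w_{βₗ}` of the complex matrix group, for a list of simple roots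
`β₁, …, βₗ` with chosen standard triples, where `w_β = exp(X_β) exp(-Y_β) exp(X_β)`. -/
def omega {c : LieSubalgebra ℝ g} {P : Set (Module.Dual ℂ (cartanC c))}
    (l : List (SimpleTriple P)) : Matrix (Fin n) (Fin n) ℂ :=
  (l.map fun t => weylFactor (t.X : Matrix (Fin n) (Fin n) ℂ) (t.Y)).prod

/-- `ω 𝔶 ω⁻¹ = σ(𝔶)`. -/
def ConjugatesNilradical {c : LieSubalgebra ℝ g} {P : Set (Module.Dual ℂ (cartanC c))}
    (l : List (SimpleTriple P)) : Prop :=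
  {A | ∃ Z ∈ nilradical P, A = omega l * (Z : Matrix (Fin n) (Fin n) ℂ) * (omega l)⁻¹} =
    {A | ∃ Z ∈ nilradical P, A = (conj Z : Matrix (Fin n) (Fin n) ℂ)}

end

/-! The next facts show that `ω` normalizes the complexified Cartan subalgebra. -/

theorem exp_mul_eq {A : Type*} [Ring A] [Algebra ℚ A] (x y : A) (hx : IsNilpotent x)
    (h3 : ⁅x, ⁅x, ⁅x, y⁆⁆⁆ = 0) :
    IsNilpotent.exp x * y =
      (y + ⁅x, y⁆ + (2 : ℚ)⁻¹ • ⁅x, ⁅x, y⁆⁆) * IsNilpotent.exp x := by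
  set L : Module.End ℚ A := LinearMap.mulLeft ℚ x with hL
  set R : Module.End ℚ A := LinearMap.mulRight ℚ x with hR
  obtain ⟨k, hk⟩ := hx
  have hLk : L ^ k = 0 := by rw [hL, LinearMap.pow_mulLeft, hk]; simp
  have hRk : R ^ k = 0 := by rw [hR, LinearMap.pow_mulRight, hk]; simp
  have hc : Commute L R := by
    ext z; simp [hL, hR, mul_assoc]
  have hD : IsNilpotent (L - R) := hc.isNilpotent_sub ⟨k, hLk⟩ ⟨k, hRk⟩
  have hcD : Commute (L - R) R := hc.sub_left (Commute.refl R)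
  have key : IsNilpotent.exp L = IsNilpotent.exp (L - R) * IsNilpotent.exp R := by
    rw [← IsNilpotent.exp_add_of_commute hcD hD ⟨k, hRk⟩, sub_add_cancel]
  have hDapp : ∀ z, (L - R) z = ⁅x, z⁆ := fun z => rfl
  have hLe : IsNilpotent.exp L y = IsNilpotent.exp x * y := by
    rw [IsNilpotent.exp_eq_sum hLk, IsNilpotent.exp_eq_sum hk]
    simp [hL, LinearMap.pow_mulLeft, Finset.sum_mul]
  have hRe : ∀ z, IsNilpotent.exp R z = z * IsNilpotent.exp x := by
    intro z
    rw [IsNilpotent.exp_eq_sum hRk, IsNilpotent.exp_eq_sum hk]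
    simp [hR, LinearMap.pow_mulRight, Finset.mul_sum]
  have hDe : IsNilpotent.exp (L - R) y = y + ⁅x, y⁆ + (2 : ℚ)⁻¹ • ⁅x, ⁅x, y⁆⁆ := by
    have h := IsNilpotent.exp_smul_eq_sum (a := L - R) (m := y) (k := 3)
      (by simpa [pow_succ, hDapp] using h3) hD
    simpa [Finset.sum_range_succ, pow_succ, hDapp] using h
  have hcomm : Commute (IsNilpotent.exp (L - R)) (IsNilpotent.exp R) := by
    rw [commute_iff_eq, ← IsNilpotent.exp_add_of_commute hcD hD ⟨k, hRk⟩,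
      ← IsNilpotent.exp_add_of_commute hcD.symm ⟨k, hRk⟩ hD, add_comm]
  rw [← hLe, key, hcomm.eq, Module.End.mul_apply, hRe, hDe]

theorem weylFactor_mul {A : Type*} [Ring A] [Algebra ℚ A] [Algebra ℂ A] (e f h H : A) (a : ℂ)
    (he : IsNilpotent e) (hf : IsNilpotent f) (h1 : ⁅e, f⁆ = h) (h2 : ⁅h, e⁆ = 2 • e)
    (h3 : ⁅h, f⁆ = -(2 • f)) (h4 : ⁅H, e⁆ = a • e) (h5 : ⁅H, f⁆ = -(a • f)) :
    weylFactor e f * H = (H - a • h) * weylFactor e f := by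
  have h2' : ⁅e, h⁆ = -(2 • e) := by rw [← lie_skew, h2]
  have h3' : ⁅f, h⁆ = 2 • f := by rw [← lie_skew, h3, neg_neg]
  have h4' : ⁅e, H⁆ = -(a • e) := by rw [← lie_skew, h4]
  have h5' : ⁅f, H⁆ = a • f := by rw [← lie_skew, h5, neg_neg]
  have h1' : ⁅f, e⁆ = -h := by rw [← lie_skew, h1]
  have half : ∀ z : A, (2 : ℚ)⁻¹ • (2 • z) = z := by
    intro z
    rw [← Nat.cast_smul_eq_nsmul ℚ 2 z, smul_smul]; norm_num
  have eH := exp_mul_eq e H he (by simp only [h4', lie_neg, lie_smul, lie_self, smul_zero, neg_zero, lie_zero])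
  have eh := exp_mul_eq e h he (by simp only [h2', lie_neg, lie_nsmul, lie_self, smul_zero, neg_zero, lie_zero])
  have ee := exp_mul_eq e e he (by simp)
  have fH := exp_mul_eq (-f) H hf.neg (by
    simp only [neg_lie, h5', lie_neg, lie_smul, lie_self, smul_zero, neg_zero, lie_zero])
  have fe := exp_mul_eq (-f) e hf.neg (by
    simp only [neg_lie, h1', h3', lie_neg, lie_nsmul, lie_self, smul_zero, neg_zero, lie_zero])
  simp only [h4', h2', lie_neg, lie_smul, lie_nsmul, lie_self, smul_zero, neg_zero, add_zero,
    lie_zero] at eH eh ee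
  simp only [neg_lie, h5', h1', h3', lie_neg, lie_smul, lie_nsmul, lie_self, smul_zero, neg_zero,
    add_zero, neg_neg, smul_neg, half, lie_zero] at fH fe
  set E := IsNilpotent.exp e with hE
  set F := IsNilpotent.exp (-f) with hF
  have hw : weylFactor e f = E * F * E := rfl
  rw [hw]
  calc E * F * E * H = E * F * (E * H) := by noncomm_ring
    _ = E * (F * H - a • (F * e)) * E := by
        rw [eH]; simp only [add_mul, mul_add, neg_mul, mul_neg, smul_mul_assoc, mul_smul_comm,
          mul_sub, sub_mul, mul_assoc]; abel
    _ = (E * H - a • (E * e) - a • (E * h)) * F * E := by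
        rw [fH, fe]; simp only [add_mul, mul_add, neg_mul, mul_neg, smul_mul_assoc, mul_smul_comm,
          mul_sub, sub_mul, mul_assoc, smul_add, smul_neg]; abel
    _ = (H - a • h) * (E * F * E) := by
        rw [eH, ee, eh]; simp only [add_mul, mul_add, neg_mul, mul_neg, smul_mul_assoc,
          mul_smul_comm, mul_sub, sub_mul, mul_assoc, smul_add, smul_neg, two_smul]; abel

theorem exp_of_not_isNilpotent {A : Type*} [Ring A] [Module ℚ A] {x : A} (hx : ¬ IsNilpotent x) :
    IsNilpotent.exp x = 0 := by
  have : nilpotencyClass x = 0 := by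
    have h : {k : ℕ | x ^ k = 0} = ∅ := Set.eq_empty_of_forall_notMem fun k hk => hx ⟨k, hk⟩
    rw [nilpotencyClass, h, Nat.sInf_empty]
  simp [IsNilpotent.exp, this]

section

variable {n : ℕ} {g : LieSubalgebra ℝ (Matrix (Fin n) (Fin n) ℝ)}
  {c : LieSubalgebra ℝ g} {P : Set (Module.Dual ℂ (cartanC c))}

theorem exists_omega_mul (l : List (SimpleTriple P)) (H : cartanC c) :
    ∃ K : cartanC c, omega l * ((H : complexify g) : Matrix (Fin n) (Fin n) ℂ) =
      ((K : complexify g) : Matrix (Fin n) (Fin n) ℂ) * omega l := by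
  induction l with
  | nil => exact ⟨H, by simp [omega]⟩
  | cons t l ih =>
    obtain ⟨K, hK⟩ := ih
    have hcons : omega (t :: l) =
        weylFactor (t.X : Matrix (Fin n) (Fin n) ℂ) (t.Y) * omega l := by simp [omega]
    by_cases hX : IsNilpotent (t.X : Matrix (Fin n) (Fin n) ℂ)
    swap
    · exact ⟨0, by simp [hcons, weylFactor, exp_of_not_isNilpotent hX]⟩
    by_cases hY : IsNilpotent (t.Y : Matrix (Fin n) (Fin n) ℂ)
    swap
    · have hY' : ¬ IsNilpotent (-(t.Y : Matrix (Fin n) (Fin n) ℂ)) := by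
        rwa [isNilpotent_neg_iff]
      exact ⟨0, by simp [hcons, weylFactor, exp_of_not_isNilpotent hY']⟩
    have co : ∀ {A B : complexify g}, A = B →
        (A : Matrix (Fin n) (Fin n) ℂ) = (B : Matrix (Fin n) (Fin n) ℂ) := fun h => by rw [h]
    have hw := weylFactor_mul _ _ ((t.H : complexify g) : Matrix (Fin n) (Fin n) ℂ)
      ((K : complexify g) : Matrix (Fin n) (Fin n) ℂ) (t.α K) hX hY
      (co t.isSl2Triple.lie_e_f) (by simpa using co t.isSl2Triple.lie_h_e_nsmul)
      (by simpa using co t.isSl2Triple.lie_h_f_nsmul) (co (t.X_mem K))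
      (by simpa using co (t.Y_mem K))
    refine ⟨K - t.α K • t.H, ?_⟩
    rw [hcons, mul_assoc, hK, ← mul_assoc, hw]
    simp [mul_assoc]

theorem exists_omega_conj (l : List (SimpleTriple P)) (H : cartanC c) :
    ∃ K : cartanC c, ((K : complexify g) : Matrix (Fin n) (Fin n) ℂ) =
      omega l * ((H : complexify g) : Matrix (Fin n) (Fin n) ℂ) * (omega l)⁻¹ := by
  obtain ⟨K, hK⟩ := exists_omega_mul l H
  by_cases hu : IsUnit (omega l).det
  · exact ⟨K, by rw [hK, mul_assoc, Matrix.mul_nonsing_inv _ hu, mul_one]⟩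
  · exact ⟨0, by rw [Matrix.nonsing_inv_apply_not_isUnit _ hu]; simp⟩

/-- The map `H ↦ ω H ω⁻¹` of the complexified Cartan subalgebra. -/
def omegaConj (l : List (SimpleTriple P)) : cartanC c →ₗ[ℂ] cartanC c where
  toFun H :=
    ⟨⟨omega l * ((H : complexify g) : Matrix (Fin n) (Fin n) ℂ) * (omega l)⁻¹, by
      obtain ⟨K, hK⟩ := exists_omega_conj l H
      rw [← hK]; exact (K : complexify g).2⟩, by
      obtain ⟨K, hK⟩ := exists_omega_conj l H
      have h : ∀ Z : complexify g, (Z : Matrix (Fin n) (Fin n) ℂ) =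
          omega l * ((H : complexify g) : Matrix (Fin n) (Fin n) ℂ) * (omega l)⁻¹ →
          Z ∈ cartanC c := fun Z hZ => by
        rw [← hK] at hZ
        rw [Subtype.ext hZ]; exact K.2
      exact h _ rfl⟩
  map_add' A B := by
    apply Subtype.ext; apply Subtype.ext; simp [mul_add, add_mul]
  map_smul' z A := by
    apply Subtype.ext; apply Subtype.ext; simp

/-- Conjugation of the complexified Cartan subalgebra. -/
def cartanConj (H : cartanC c) : cartanC c :=
  ⟨conj H, by
    refine ⟨?_, ?_⟩
    · rw [rePart_conj]; exact H.2.1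
    · rw [imPart_conj]; exact c.neg_mem H.2.2⟩

/-- The linear form `λ^σ`, `λ^σ(H) = conj (λ (σ H))`. -/
def sigmaWeight (μ : Module.Dual ℂ (cartanC c)) : Module.Dual ℂ (cartanC c) where
  toFun H := starRingEnd ℂ (μ (cartanConj H))
  map_add' A B := by
    have : cartanConj (A + B) = cartanConj A + cartanConj B := by
      apply Subtype.ext; apply Subtype.ext; ext; simp [cartanConj, conj]
    rw [this, map_add, map_add]
  map_smul' z A := by
    have : cartanConj (z • A) = starRingEnd ℂ z • cartanConj A := by
      apply Subtype.ext; apply Subtype.ext; ext; simp [cartanConj, conj]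
    rw [this, map_smul]; simp

/-- The linear form `ω⁻¹ λ^σ`, that is `H ↦ λ^σ(ω H ω⁻¹)`. -/
def theta (l : List (SimpleTriple P)) (μ : Module.Dual ℂ (cartanC c)) :
    Module.Dual ℂ (cartanC c) :=
  (sigmaWeight μ).comp (omegaConj l)

/-! ### The complexified representation -/

variable {V : Type*} [AddCommGroup V] [Module ℝ V]

/-- The conjugation `z ⊗ v ↦ conj z ⊗ v` of the complexification of `V`. -/
def vconj : (ℂ ⊗[ℝ] V) →ₗ[ℝ] (ℂ ⊗[ℝ] V) :=
  TensorProduct.map Complex.conjAe.toLinearMap LinearMap.id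

/-- The complexification `ρ(X + iY) = ρ(X) + iρ(Y)` of a real representation. -/
def rhoC (ρ : g →ₗ⁅ℝ⁆ Module.End ℝ V) : complexify g →ₗ⁅ℂ⁆ Module.End ℂ (ℂ ⊗[ℝ] V) where
  toFun Z := (ρ (rePart Z)).baseChange ℂ + Complex.I • (ρ (imPart Z)).baseChange ℂ
  map_add' A B := by
    simp only [map_add, LinearMap.baseChange_add, smul_add]; abel
  map_smul' z A := by
    rw [rePart_smul, imPart_smul]
    simp only [map_add, map_sub, map_smul, LinearMap.baseChange_add, LinearMap.baseChange_sub,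
      LinearMap.baseChange_smul, RingHom.id_apply]
    ext v
    simp only [TensorProduct.AlgebraTensorModule.curry_apply, LinearMap.restrictScalars_self,
      TensorProduct.curry_apply, LinearMap.coe_restrictScalars, LinearMap.add_apply,
      LinearMap.sub_apply, LinearMap.smul_apply, LinearMap.baseChange_tmul, ← Complex.coe_smul,
      smul_add, smul_smul]
    conv_rhs => rw [← Complex.re_add_im z]
    rw [add_mul, mul_assoc, Complex.I_mul_I]
    module
  map_lie' := by
    intro A B
    rw [rePart_lie, imPart_lie]
    simp only [map_add, map_sub, LieHom.map_lie, LinearMap.baseChange_add,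
      LinearMap.baseChange_sub, LieRing.of_associative_ring_bracket, Module.End.mul_eq_comp,
      LinearMap.baseChange_comp]
    simp only [LinearMap.add_comp, LinearMap.comp_add, LinearMap.smul_comp, LinearMap.comp_smul,
      smul_add, smul_sub, smul_smul, Complex.I_mul_I]
    module

/-- A high weight vector of weight `μ`, relative to `𝔶` and `𝔠 + i𝔠`. -/
structure IsHighWeightVector (P : Set (Module.Dual ℂ (cartanC c)))
    (ρ : g →ₗ⁅ℝ⁆ Module.End ℝ V) (μ : Module.Dual ℂ (cartanC c)) (v : ℂ ⊗[ℝ] V) : Prop where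
  ne_zero : v ≠ 0
  nilradical_apply : ∀ Z ∈ nilradical P, rhoC ρ Z v = 0
  cartan_apply : ∀ H : cartanC c, rhoC ρ H v = μ H • v

/-- Invariance of a complex subspace under the complexified Lie algebra. -/
def IsInvariant (ρ : g →ₗ⁅ℝ⁆ Module.End ℝ V) (M : Submodule ℂ (ℂ ⊗[ℝ] V)) : Prop :=
  ∀ Z : complexify g, ∀ v ∈ M, rhoC ρ Z v ∈ M

/-- Invariance of a complex subspace under conjugation. -/
def IsConjInvariant (M : Submodule ℂ (ℂ ⊗[ℝ] V)) : Prop :=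
  ∀ v ∈ M, vconj v ∈ M

/-- The isotypical component of weight `μ`: the invariant subspace generated by the high weight
vectors of weight `μ`. -/
def isotypical (P : Set (Module.Dual ℂ (cartanC c))) (ρ : g →ₗ⁅ℝ⁆ Module.End ℝ V)
    (μ : Module.Dual ℂ (cartanC c)) : Submodule ℂ (ℂ ⊗[ℝ] V) :=
  sInf {N | IsInvariant ρ N ∧ ∀ v, IsHighWeightVector P ρ μ v → v ∈ N}

/-- A basis of high weight vectors of `M`: linearly independent high weight vectors in `M` which
span all the high weight vectors in `M`. -/
structure IsHighWeightBasis (P : Set (Module.Dual ℂ (cartanC c))) (ρ : g →ₗ⁅ℝ⁆ Module.End ℝ V)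
    (M : Submodule ℂ (ℂ ⊗[ℝ] V)) {d : ℕ} (w : Fin d → ℂ ⊗[ℝ] V) : Prop where
  mem : ∀ j, w j ∈ M
  isHighWeightVector : ∀ j, ∃ μ, IsHighWeightVector P ρ μ (w j)
  linearIndependent : LinearIndependent ℂ w
  mem_span : ∀ u ∈ M, (∃ μ, IsHighWeightVector P ρ μ u) → u ∈ Submodule.span ℂ (Set.range w)

/-- The operator `ω_ρ = w_{β₁,ρ} ⋯ w_{βₗ,ρ}`, where `w_{β,ρ}` is the product
`exp(ρ(X_β)) exp(-ρ(Y_β)) exp(ρ(X_β))`. -/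
def omegaRho (ρ : g →ₗ⁅ℝ⁆ Module.End ℝ V) (l : List (SimpleTriple P)) :
    Module.End ℂ (ℂ ⊗[ℝ] V) :=
  (l.map fun t => weylFactor (rhoC ρ t.X) (rhoC ρ t.Y)).prod

/-- The vector `ω_ρ⁻¹ (conj v)`. -/
def twistedConj (ρ : g →ₗ⁅ℝ⁆ Module.End ℝ V) (l : List (SimpleTriple P)) (v : ℂ ⊗[ℝ] V) :
    ℂ ⊗[ℝ] V :=
  Ring.inverse (omegaRho ρ l) (vconj v)

end

end RealRep

end

/-! Everything rests on a complement `N` of `M` in the isotypical component that is invariant under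
the Lie algebra and under conjugation. Semisimplicity is given over the reals, so Weyl's theorem is
proved there, through Casimir operators and the first Whitehead lemma, and applied to `V^ℂ` as a
real representation. The resulting real linear projection onto `M` is averaged against
multiplication by `i` and then against conjugation; the kernel of the average is a complement of `M`
in `V^ℂ` (`exists_invariant_complement`), and intersecting it with the component gives `N`.

The map `v ↦ ω_ρ⁻¹ v̄` sends high weight vectors of weight `λ` to high weight vectors of weight
`ω⁻¹λ^σ = λ` (`IsHighWeightVector.twistedConj`). Hence the component is conjugation invariant
(`isConjInvariant_isotypical`). The same map preserves `N` (`twistedConj_mem`).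

Since `M` is proper, `N` contains a high weight vector `v` of weight `λ`
(`exists_isHighWeightVector_mem`). Both `v` and `u = ω_ρ⁻¹ v̄` lie in `N`, while the `w_j` lie in
`M`, and `M ∩ N = 0`. So either `u` is proportional to `v`, or `w_1, …, w_d, v, u` are independent:
these are the two alternatives. -/

noncomputable section

namespace RealRep

/-! ### Complete reducibility over a field of characteristic zero -/

section Weyl

open LieAlgebra LieModule Module

/-- The tensor `∑ bᵢ ⊗ b'ᵢ` of dual bases is invariant, because invariance of `B` makes the matrices
of `x` in the two bases negative transposes of each other. Allowing an arbitrary bilinear `F` lets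
it serve both the Casimir operator and its analogue with a cocycle in the second slot. -/
theorem sum_dualBasis_lie {K L J E ι : Type*} [Field K] [LieRing L] [LieAlgebra K L]
    [AddCommGroup J] [Module K J] [LieRingModule L J] [LieModule K L J] [AddCommGroup E]
    [Module K E] [Fintype ι] [DecidableEq ι] [FiniteDimensional K J]
    (B : LinearMap.BilinForm K J) (hB : B.Nondegenerate) (hs : B.IsSymm)
    (hinv : ∀ (x : L) (y z : J), B ⁅x, y⁆ z = -B y ⁅x, z⁆)
    (b : Basis ι K J) (F : J →ₗ[K] J →ₗ[K] E) (x : L) :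
    ∑ i, (F ⁅x, b i⁆ (B.dualBasis hB b i) + F (b i) ⁅x, B.dualBasis hB b i⁆) = 0 := by
  set b' := B.dualBasis hB b with hb'
  have h1 : ∀ y : J, y = ∑ j, B y (b j) • b' j := fun y => by
    conv_lhs => rw [← b'.sum_repr y]
    simp only [hb', LinearMap.BilinForm.dualBasis_repr_apply]
  have h2 : ∀ y : J, y = ∑ j, B y (b' j) • b j := fun y => by
    conv_lhs => rw [← b.sum_repr y]
    refine Finset.sum_congr rfl fun j _ => ?_
    congr 1
    have := LinearMap.BilinForm.dualBasis_repr_apply hB b' y j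
    rwa [hb', LinearMap.BilinForm.dualBasis_dualBasis hB hs b] at this
  rw [Finset.sum_add_distrib]
  have e1 : ∀ i, F ⁅x, b i⁆ (b' i) = ∑ j, B ⁅x, b i⁆ (b' j) • F (b j) (b' i) := fun i => by
    conv_lhs => rw [h2 ⁅x, b i⁆]
    simp
  have e2 : ∀ i, F (b i) ⁅x, b' i⁆ = ∑ j, B ⁅x, b' i⁆ (b j) • F (b i) (b' j) := fun i => by
    conv_lhs => rw [h1 ⁅x, b' i⁆]
    simp
  simp only [e1, e2]
  rw [Finset.sum_comm, ← Finset.sum_add_distrib]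
  refine Finset.sum_eq_zero fun i _ => ?_
  rw [← Finset.sum_add_distrib]
  refine Finset.sum_eq_zero fun j _ => ?_
  rw [← add_smul, hinv, hs.eq, neg_add_cancel, zero_smul]

variable {K : Type*} {L : Type*} [Field K] [CharZero K] [LieRing L] [LieAlgebra K L]
  [FiniteDimensional K L] [HasTrivialRadical K L]

/-- The intersection of `I` with the Killing complement of `D = [I, I]` is abelian, since its
brackets lie both in `D` and in that complement. By semisimplicity it vanishes, and the modular law
leaves `I = D`. -/
theorem lieIdeal_lie_self (I : LieIdeal K L) : ⁅I, I⁆ = I := by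
  set D : LieIdeal K L := ⁅I, I⁆ with hD
  have hc := D.isCompl_killingCompl
  have hDI : D ≤ I := LieSubmodule.lie_le_left I I
  have h0 : I ⊓ D.killingCompl = ⊥ := by
    have : IsLieAbelian (I ⊓ D.killingCompl : LieIdeal K L) := by
      rw [LieSubmodule.lie_abelian_iff_lie_self_eq_bot, eq_bot_iff, ← hc.inf_eq_bot]
      exact le_inf (LieSubmodule.mono_lie inf_le_left inf_le_left)
        ((LieSubmodule.lie_le_left _ _).trans inf_le_right)
    exact IsKilling.ideal_eq_bot_of_isLieAbelian _
  refine le_antisymm hDI ?_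
  calc I = (D ⊔ D.killingCompl) ⊓ I := by rw [hc.sup_eq_top, top_inf_eq]
    _ = D ⊔ D.killingCompl ⊓ I := (sup_inf_assoc_of_le _ hDI)
    _ = D := by rw [inf_comm, h0, sup_bot_eq]
    _ ≤ D := le_rfl

/-- The radical of the trace form, as an ideal. -/
def traceFormRadical (K L V : Type*) [Field K] [LieRing L] [LieAlgebra K L] [AddCommGroup V]
    [Module K V] [LieRingModule L V] [LieModule K L V] : LieIdeal K L where
  toSubmodule := LinearMap.ker (traceForm K L V)
  lie_mem := by
    intro x y hy
    have hy' : traceForm K L V y = 0 := hy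
    change traceForm K L V ⁅x, y⁆ = 0
    ext z
    rw [← lie_skew, map_neg, LinearMap.neg_apply, traceForm_apply_lie_apply, hy']
    simp

/-- Cartan's criterion makes `[I, I]`, which is all of `I`, act nilpotently. The vectors killed by
`I` are then a nonzero submodule, hence everything by irreducibility. -/
theorem lie_eq_zero_of_mem_traceFormRadical {V : Type*} [AddCommGroup V] [Module K V]
    [LieRingModule L V] [LieModule K L V] [FiniteDimensional K V] [LieModule.IsIrreducible K L V]
    {x : L} (hx : x ∈ traceFormRadical K L V) (v : V) : ⁅x, v⁆ = 0 := by
  set I := traceFormRadical K L V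
  have hnt : Nontrivial V := LieModule.nontrivial_of_isIrreducible K L V
  have hzero : traceForm K I V = 0 := by
    ext y z
    have hy : traceForm K L V y = 0 := y.2
    exact LinearMap.congr_fun hy z
  have hnil := LieModule.isNilpotent_derivedSeries_of_traceForm_eq_zero hzero
  have hnilI : LieModule.IsNilpotent I V := by
    rw [isNilpotent_iff_forall' (R := K)] at hnil ⊢
    rintro ⟨y, hy⟩
    refine hnil ⟨⟨y, hy⟩, ?_⟩
    rw [LieIdeal.derivedSeries_eq_derivedSeriesOfIdeal_comap, LieIdeal.mem_comap]
    rw [derivedSeriesOfIdeal_succ, derivedSeriesOfIdeal_zero, lieIdeal_lie_self]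
    exact hy
  have hn := nontrivial_max_triv_of_isNilpotent K I V
  let U : LieSubmodule K L V :=
    { carrier := {v | ∀ y ∈ I, ⁅y, v⁆ = 0}
      add_mem' := fun ha hb y hy => by rw [lie_add, ha y hy, hb y hy, add_zero]
      zero_mem' := fun y _ => lie_zero y
      smul_mem' := fun c v hv y hy => by rw [lie_smul, hv y hy, smul_zero]
      lie_mem := fun {z v} hv y hy => by
        rw [leibniz_lie, hv y hy, lie_zero, add_zero]
        exact hv _ (lie_mem_left K L I y z hy) }
  have hU : Nontrivial U := by
    obtain ⟨u, hu⟩ := exists_ne (0 : maxTrivSubmodule K I V)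
    refine ⟨⟨⟨u, fun y hy => ?_⟩, 0, fun h => hu ?_⟩⟩
    · exact (mem_maxTrivSubmodule K I V (u : V)).1 u.2 ⟨y, hy⟩
    · have h' : (u : V) = 0 := congrArg (fun t : U => (t : V)) h
      exact Subtype.ext h'
  have : v ∈ U := by rw [LieSubmodule.eq_top_of_isIrreducible K L V U]; trivial
  exact this x hx


/-- The first Whitehead lemma for an irreducible module, with the Casimir element of its trace
form. -/
theorem exists_eq_lie_of_cocycle_of_isIrreducible {V : Type*} [AddCommGroup V] [Module K V]
    [LieRingModule L V] [LieModule K L V] [FiniteDimensional K V] [LieModule.IsIrreducible K L V]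
    (f : L →ₗ[K] V) (hf : ∀ x y, f ⁅x, y⁆ = ⁅x, f y⁆ - ⁅y, f x⁆) :
    ∃ v : V, ∀ x, f x = ⁅x, v⁆ := by
  classical
  set I := traceFormRadical K L V
  set J := I.killingCompl
  have hc : IsCompl I J := I.isCompl_killingCompl
  have hdec : ∀ x : L, ∃ y ∈ I, ∃ z ∈ J, y + z = x := fun x => by
    have : x ∈ I ⊔ J := by rw [hc.sup_eq_top]; trivial
    exact (LieSubmodule.mem_sup ..).1 this
  -- The cocycle identity kills brackets of elements of `I`, as `I` acts by zero, and such brackets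
  -- span `I`.
  have hfI : ∀ x ∈ I, f x = 0 := by
    have h : LieSubmodule.toSubmodule I ≤ LinearMap.ker f := by
      rw [← lieIdeal_lie_self I, LieSubmodule.lieIdeal_oper_eq_linear_span', Submodule.span_le]
      rintro _ ⟨x, hx, y, hy, rfl⟩
      change f _ = 0
      rw [hf, lie_eq_zero_of_mem_traceFormRadical hx, lie_eq_zero_of_mem_traceFormRadical hy,
        sub_zero]
    exact fun x hx => h hx
  let B : LinearMap.BilinForm K J := traceForm K J V
  have hBa : ∀ y z : J, B y z = traceForm K L V y z := fun y z => rfl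
  have hs : B.IsSymm := ⟨traceForm_comm K J V⟩
  have hinv : ∀ (x : L) (y z : J), B ⁅x, y⁆ z = -B y ⁅x, z⁆ := fun x y z => by
    rw [hBa, hBa, LieSubmodule.coe_bracket, LieSubmodule.coe_bracket, ← lie_skew, map_neg,
      LinearMap.neg_apply, traceForm_apply_lie_apply]
  have hB : B.Nondegenerate := by
    refine hs.isRefl.nondegenerate_iff_separatingLeft.2 ?_
    intro y hy
    have hyI : (y : L) ∈ I := by
      change traceForm K L V y = 0
      ext x
      obtain ⟨a, ha, b, hb, rfl⟩ := hdec x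
      have h1 : traceForm K L V y a = 0 := by
        rw [traceForm_comm]
        have : traceForm K L V a = 0 := ha
        rw [this]; rfl
      rw [map_add, h1, zero_add]
      exact hy ⟨b, hb⟩
    have : (y : L) ∈ I ⊓ J := ⟨hyI, y.2⟩
    rw [hc.inf_eq_bot] at this
    exact Subtype.ext this
  let b := finBasis K J
  let b' := B.dualBasis hB b
  let φ : J →ₗ[K] Module.End K V := (toEnd K L V : L →ₗ[K] Module.End K V) ∘ₗ J.subtype
  have hφ : ∀ (y : J) (v : V), φ y v = ⁅(y : L), v⁆ := fun y v => rfl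
  -- The Casimir operator of the trace form, which is nondegenerate on the complement `J`.
  let C : Module.End K V := ∑ i, φ (b i) * φ (b' i)
  have hCa : ∀ v, C v = ∑ i, ⁅(b i : L), ⁅(b' i : L), v⁆⁆ := fun v => by
    simp only [C, LinearMap.sum_apply, Module.End.mul_apply, hφ]
  have hCcomm : ∀ (x : L) (v : V), C ⁅x, v⁆ = ⁅x, C v⁆ := fun x v => by
    have h := sum_dualBasis_lie B hB hs hinv b ((LinearMap.mul K (Module.End K V)).compl₁₂ φ φ) x
    have h' := LinearMap.congr_fun h v
    simp only [LinearMap.compl₁₂_apply, LinearMap.mul_apply', LinearMap.sum_apply,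
      LinearMap.add_apply, Module.End.mul_apply, hφ, LieSubmodule.coe_bracket,
      LinearMap.zero_apply] at h'
    rw [hCa, hCa, lie_sum, ← sub_eq_zero, ← neg_eq_zero, ← h', ← Finset.sum_sub_distrib,
      ← Finset.sum_neg_distrib]
    refine Finset.sum_congr rfl fun i _ => ?_
    simp only [lie_lie, lie_sub]
    abel
  -- With `s = ∑ bᵢ · f(b'ᵢ)` this says `x · s = C (f x)`, so a preimage of `s` under `C` is the
  -- vector sought as soon as `C` is invertible.
  have hCf : ∀ x, ⁅x, ∑ i, ⁅(b i : L), f (b' i)⁆⁆ = C (f x) := fun x => by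
    let F : J →ₗ[K] J →ₗ[K] V :=
      LinearMap.mk₂ K (fun y z => ⁅(y : L), f z⁆) (by simp) (by simp) (by simp) (by simp)
    have h := sum_dualBasis_lie B hB hs hinv b F x
    simp only [F, LinearMap.mk₂_apply, LieSubmodule.coe_bracket] at h
    rw [hCa, lie_sum, ← sub_eq_zero, ← h, ← Finset.sum_sub_distrib]
    refine Finset.sum_congr rfl fun i _ => ?_
    change _ = ⁅⁅x, (b i : L)⁆, f (b' i)⁆ + ⁅(b i : L), f ⁅x, (b' i : L)⁆⁆
    rw [hf]
    simp only [lie_lie, lie_sub]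
    abel
  let U : LieSubmodule K L V :=
    { LinearMap.ker C with
      lie_mem := fun {x v} hv => by
        change C _ = 0
        rw [hCcomm, show C v = 0 from hv, lie_zero] }
  -- Schur's alternative for the submodule `ker C`. If `C = 0`, its trace `dim J` vanishes, so `J =
  -- 0` and `f = 0`; otherwise `C` is bijective.
  by_cases hU : Nontrivial U
  · have hC0 : C = 0 := by
      ext v
      have : v ∈ U := by rw [LieSubmodule.eq_top_of_isIrreducible K L V U]; trivial
      exact this
    have htr : LinearMap.trace K V C = (finrank K J : K) := by
      simp only [C, map_sum]
      have : ∀ i, LinearMap.trace K V (φ (b i) * φ (b' i)) = 1 := fun i => by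
        have := LinearMap.BilinForm.apply_dualBasis_right hB hs b i i
        rwa [if_pos rfl] at this
      simp [this]
    rw [hC0, map_zero] at htr
    have hfr : finrank K J = 0 := by exact_mod_cast htr.symm
    have hJ0 : ∀ z ∈ J, z = 0 := fun z hz => by
      have := finrank_zero_iff.1 hfr
      exact congrArg Subtype.val (Subsingleton.elim (⟨z, hz⟩ : J) 0)
    refine ⟨0, fun x => ?_⟩
    obtain ⟨y, hy, z, hz, rfl⟩ := hdec x
    rw [hJ0 z hz, add_zero, hfI y hy, lie_zero]
  · have hinj : LinearMap.ker C = ⊥ := by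
      rw [not_nontrivial_iff_subsingleton] at hU
      rw [eq_bot_iff]
      intro v hv
      exact congrArg Subtype.val (Subsingleton.elim (⟨v, hv⟩ : U) 0)
    have hsurj := LinearMap.range_eq_top.1 (LinearMap.ker_eq_bot_iff_range_eq_top.1 hinj)
    obtain ⟨v, hv⟩ := hsurj (∑ i, ⁅(b i : L), f (b' i)⁆)
    refine ⟨v, fun x => LinearMap.ker_eq_bot.1 hinj ?_⟩
    rw [← hCf, hCcomm, hv]

/-- The first Whitehead lemma. -/
theorem exists_eq_lie_of_cocycle {V : Type*} [AddCommGroup V] [Module K V]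
    [LieRingModule L V] [LieModule K L V] [FiniteDimensional K V]
    (f : L →ₗ[K] V) (hf : ∀ x y, f ⁅x, y⁆ = ⁅x, f y⁆ - ⁅y, f x⁆) :
    ∃ v : V, ∀ x, f x = ⁅x, v⁆ := by
  induction hn : finrank K V using Nat.strong_induction_on generalizing V with
  | _ n ih =>
    cases subsingleton_or_nontrivial V with
    | inl h => exact ⟨0, fun x => Subsingleton.elim _ _⟩
    | inr h =>
      by_cases hirr : ∀ N : LieSubmodule K L V, N ≠ ⊥ → N = ⊤
      · have := LieModule.IsIrreducible.mk hirr
        exact exists_eq_lie_of_cocycle_of_isIrreducible f hf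
      -- Dévissage along a proper nonzero submodule `N`: once `f` is a coboundary modulo `N`,
      -- subtracting that coboundary leaves a cocycle with values in `N`.
      · push Not at hirr
        obtain ⟨N, hN0, hN1⟩ := hirr
        have hlt : finrank K N < n := by
          rw [← hn]
          exact Submodule.finrank_lt (by simpa using hN1)
        have hlt' : finrank K (V ⧸ N) < n := by
          have h1 := Submodule.finrank_quotient_add_finrank (N : Submodule K V)
          have h2 : 0 < finrank K (N : Submodule K V) :=
            Submodule.one_le_finrank_iff.2 (by simpa using hN0)
          change finrank K (V ⧸ (N : Submodule K V)) < n
          omega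
        obtain ⟨q, hq⟩ := ih _ hlt' (V := V ⧸ N)
          ((LieSubmodule.Quotient.mk' N : V →ₗ[K] V ⧸ N) ∘ₗ f) (fun x y => by
            change LieSubmodule.Quotient.mk' N (f ⁅x, y⁆) = ⁅x, LieSubmodule.Quotient.mk' N (f y)⁆ -
              ⁅y, LieSubmodule.Quotient.mk' N (f x)⁆
            rw [hf, map_sub, LieModuleHom.map_lie, LieModuleHom.map_lie]) rfl
        obtain ⟨v, rfl⟩ := LieSubmodule.Quotient.surjective_mk' N q
        have hmem : ∀ x, f x - ⁅x, v⁆ ∈ N := fun x => by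
          rw [← LieSubmodule.Quotient.mk_eq_zero, map_sub, sub_eq_zero, LieModuleHom.map_lie]
          exact hq x
        obtain ⟨u, hu⟩ := ih _ hlt (V := N)
          (LinearMap.codRestrict (N : Submodule K V)
            (f - (toEnd K L V : L →ₗ[K] Module.End K V).flip v) hmem) (fun x y => by
            apply Subtype.ext
            change f ⁅x, y⁆ - ⁅⁅x, y⁆, v⁆ = ⁅x, f y - ⁅y, v⁆⁆ - ⁅y, f x - ⁅x, v⁆⁆
            rw [hf, lie_lie, lie_sub, lie_sub]
            abel) rfl
        refine ⟨v + u, fun x => ?_⟩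
        have := congrArg Subtype.val (hu x)
        have h3 : f x - ⁅x, v⁆ = ⁅x, (u : V)⁆ := this
        rw [lie_add, ← h3]
        abel

/-- Weyl's complete reducibility theorem: an invariant subspace has an equivariant projection. -/
theorem exists_equivariant_projection {M : Type*} [AddCommGroup M] [Module K M]
    [FiniteDimensional K M] (σ : L →ₗ⁅K⁆ Module.End K M) (N : Submodule K M)
    (hN : ∀ x, ∀ m ∈ N, σ x m ∈ N) :
    ∃ p : Module.End K M, (∀ m, p m ∈ N) ∧ (∀ m ∈ N, p m = m) ∧
      ∀ x m, p (σ x m) = σ x (p m) := by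
  let _ : LieRingModule L M := LieRingModule.compLieHom M σ
  have _ : LieModule K L M := LieModule.compLieHom M σ
  have hlie : ∀ (x : L) (φ : M →ₗ[K] M) (m : M), ⁅x, φ⁆ m = σ x (φ m) - φ (σ x m) :=
    fun _ _ _ => rfl
  obtain ⟨r, hr⟩ := LinearMap.exists_leftInverse_of_injective N.subtype N.ker_subtype
  let q : M →ₗ[K] M := N.subtype ∘ₗ r
  have hqN : ∀ m, q m ∈ N := fun m => (r m).2
  have hq1 : ∀ m ∈ N, q m = m := fun m hm =>
    congrArg Subtype.val (LinearMap.congr_fun hr (⟨m, hm⟩ : N))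
  -- For a linear projection `q` onto `N`, the cocycle `x ↦ [x, q]` takes values in `E`, although
  -- `q` need not lie in `E`. Writing it as `[x, φ]` with `φ ∈ E` makes `q - φ` equivariant and
  -- still a projection onto `N`.
  let E : LieSubmodule K L (M →ₗ[K] M) :=
    { carrier := {φ | (∀ m, φ m ∈ N) ∧ ∀ m ∈ N, φ m = 0}
      add_mem' := fun ha hb => ⟨fun m => N.add_mem (ha.1 m) (hb.1 m), fun m hm => by
        rw [LinearMap.add_apply, ha.2 m hm, hb.2 m hm, add_zero]⟩
      zero_mem' := ⟨fun _ => N.zero_mem, fun _ _ => rfl⟩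
      smul_mem' := fun c φ h => ⟨fun m => N.smul_mem _ (h.1 m), fun m hm => by
        rw [LinearMap.smul_apply, h.2 m hm, smul_zero]⟩
      lie_mem := fun {x φ} h => ⟨fun m => N.sub_mem (hN x _ (h.1 m)) (h.1 _), fun m hm => by
        rw [hlie, h.2 m hm, h.2 _ (hN x m hm), map_zero, sub_zero]⟩ }
  have hE : ∀ x : L, ⁅x, q⁆ ∈ E := fun x => by
    refine ⟨fun m => N.sub_mem (hN x _ (hqN m)) (hqN _), fun m hm => ?_⟩
    rw [hlie, hq1 m hm, hq1 _ (hN x m hm), sub_self]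
  obtain ⟨⟨φ, hφ⟩, h⟩ := exists_eq_lie_of_cocycle (V := E)
    (LinearMap.codRestrict (E : Submodule K (M →ₗ[K] M))
      ((toEnd K L (M →ₗ[K] M) : L →ₗ[K] Module.End K (M →ₗ[K] M)).flip q) hE)
    (fun x y => Subtype.ext (lie_lie x y q))
  have h' : ∀ x : L, ⁅x, q⁆ = ⁅x, φ⁆ := fun x => congrArg Subtype.val (h x)
  refine ⟨q - φ, fun m => N.sub_mem (hqN m) (hφ.1 m), fun m hm => ?_, fun x m => ?_⟩
  · rw [LinearMap.sub_apply, hq1 m hm, hφ.2 m hm, sub_zero]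
  · have := LinearMap.congr_fun (h' x) m
    rw [hlie, hlie] at this
    rw [LinearMap.sub_apply, LinearMap.sub_apply, map_sub, sub_eq_sub_iff_sub_eq_sub,
      ← neg_sub (σ x (q m)), this, neg_sub]

end Weyl

/-! ### Nonvanishing of wedge products of independent vectors -/

section Exterior

variable {K E : Type*} [Field K] [AddCommGroup E] [Module K E]

/-- A left inverse of the coordinate map of `w` pulls the determinant back to an alternating form
with value 1 on `w`; that form factors through the exterior algebra. -/
theorem ιMulti_ne_zero {d : ℕ} {w : Fin d → E} (hw : LinearIndependent K w) :
    ExteriorAlgebra.ιMulti K d w ≠ 0 := by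
  obtain ⟨f, hf⟩ := LinearMap.exists_leftInverse_of_injective _
    (LinearMap.ker_eq_bot.2 hw)
  let φ : E →ₗ[K] (Fin d → K) := Finsupp.lcoeFun ∘ₗ f
  have hφ : ∀ i, φ (w i) = Pi.single i 1 := fun i => by
    have h := LinearMap.congr_fun hf (Finsupp.single i 1)
    simp only [LinearMap.comp_apply, Finsupp.linearCombination_single, one_smul,
      LinearMap.id_apply] at h
    simp [φ, h, Finsupp.single_eq_pi_single]
  intro h
  have h1 := ExteriorAlgebra.liftAlternating_apply_ιMulti
    (Pi.single d (Matrix.detRowAlternating.compLinearMap φ) :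
      ∀ i, E [⋀^Fin i]→ₗ[K] K) w
  rw [h, map_zero, Pi.single_eq_same, AlternatingMap.compLinearMap_apply] at h1
  have h2 : (fun i => φ (w i)) = (1 : Matrix (Fin d) (Fin d) K) := by
    ext i j
    rw [hφ, Matrix.one_apply, Pi.single_apply]
    simp [eq_comm]
  have h3 : Matrix.det (fun i => φ (w i)) = 0 := h1.symm
  rw [h2, Matrix.det_one] at h3
  exact one_ne_zero h3

theorem ιMulti_mul_ι {d : ℕ} (w : Fin d → E) (v : E) :
    ExteriorAlgebra.ιMulti K d w * ExteriorAlgebra.ι K v =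
      ExteriorAlgebra.ιMulti K (d + 1) (Fin.snoc w v : Fin (d + 1) → E) := by
  have h : ExteriorAlgebra.ι K v = ExteriorAlgebra.ιMulti K 1 ![v] := by
    simp [ExteriorAlgebra.ιMulti_apply]
  rw [h, ExteriorAlgebra.ιMulti_mul_ιMulti, Fin.append_right_eq_snoc]
  rfl

theorem ιMulti_mul_ι_ne_zero {d : ℕ} {w : Fin d → E} (hw : LinearIndependent K w) {v : E}
    (hv : v ∉ Submodule.span K (Set.range w)) :
    ExteriorAlgebra.ιMulti K d w * ExteriorAlgebra.ι K v ≠ 0 := by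
  rw [ιMulti_mul_ι]
  exact ιMulti_ne_zero (hw.finSnoc hv)

theorem ιMulti_mul_ι_mul_ι_ne_zero {d : ℕ} {w : Fin d → E} (hw : LinearIndependent K w) {v u : E}
    (hv : v ∉ Submodule.span K (Set.range w))
    (hu : u ∉ Submodule.span K (insert v (Set.range w))) :
    ExteriorAlgebra.ιMulti K d w * ExteriorAlgebra.ι K v * ExteriorAlgebra.ι K u ≠ 0 := by
  rw [ιMulti_mul_ι]
  refine ιMulti_mul_ι_ne_zero (hw.finSnoc hv) ?_
  rwa [Fin.range_snoc]

end Exterior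

/-! ### Nilpotency and exponentials -/

section Exponential

/-- If no power of `e` vanished, the `e ^ k` would be eigenvectors of `ad h` for the distinct
eigenvalues `2k`, infinitely many in finite dimension. -/
theorem isNilpotent_of_commutator_eq {A : Type*} [Ring A] [Algebra ℂ A] [FiniteDimensional ℂ A]
    {h e : A} (he : h * e - e * h = 2 • e) : IsNilpotent e := by
  by_contra hn
  have hne : ∀ k, e ^ k ≠ 0 := fun k hk => hn ⟨k, hk⟩
  have hk : ∀ k : ℕ, h * e ^ k - e ^ k * h = (2 * k) • e ^ k := fun k => by
    induction k with
    | zero => simp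
    | succ k ih =>
      calc h * e ^ (k + 1) - e ^ (k + 1) * h
          = (h * e ^ k - e ^ k * h) * e + e ^ k * (h * e - e * h) := by
            rw [pow_succ]; noncomm_ring
        _ = (2 * (k + 1)) • e ^ (k + 1) := by
            rw [ih, he, pow_succ, smul_mul_assoc, mul_smul_comm, ← add_smul]; ring_nf
  have hli := Module.End.eigenvectors_linearIndependent'
    (LinearMap.mulLeft ℂ h - LinearMap.mulRight ℂ h) (fun k : ℕ => ((2 * k : ℕ) : ℂ))
    (fun a b hab => by
      have : 2 * a = 2 * b := Nat.cast_injective (R := ℂ) hab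
      omega) (fun k => e ^ k) (fun k => by
      refine ⟨Module.End.mem_eigenspace_iff.2 ?_, hne k⟩
      rw [LinearMap.sub_apply, LinearMap.mulLeft_apply, LinearMap.mulRight_apply, hk,
        Nat.cast_smul_eq_nsmul])
  exact Module.Finite.not_linearIndependent_of_infinite _ hli

theorem rat_smul_mem {A : Type*} [AddCommGroup A] [Module ℂ A] [Module ℚ A] (S : Submodule ℂ A)
    (q : ℚ) {z : A} (hz : z ∈ S) : q • z ∈ S := by
  rw [← Rat.cast_smul_eq_qsmul ℂ q z]
  exact S.smul_mem _ hz

/-- Left multiplication is right multiplication plus the commutator, and these commute, so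
conjugation by `exp (r x)` is the exponential of `ad (r x)`. This is a finite sum of iterated
brackets, so it preserves the range of `r`. -/
theorem exists_exp_mul {G A : Type*} [LieRing G] [LieAlgebra ℂ G] [Ring A] [Algebra ℂ A]
    [Algebra ℚ A] (r : G →ₗ[ℂ] A) (hr : ∀ x y, r ⁅x, y⁆ = r x * r y - r y * r x) (x : G)
    (hx : IsNilpotent (r x)) (Z : G) :
    ∃ Z', IsNilpotent.exp (r x) * r Z = r Z' * IsNilpotent.exp (r x) := by
  obtain ⟨k, hk⟩ := hx
  set L : Module.End ℚ A := LinearMap.mulLeft ℚ (r x) with hL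
  set R : Module.End ℚ A := LinearMap.mulRight ℚ (r x) with hR
  have hLk : L ^ k = 0 := by rw [hL, LinearMap.pow_mulLeft, hk]; simp
  have hRk : R ^ k = 0 := by rw [hR, LinearMap.pow_mulRight, hk]; simp
  have hc : Commute L R := by ext z; simp [hL, hR, mul_assoc]
  have hD : IsNilpotent (L - R) := hc.isNilpotent_sub ⟨k, hLk⟩ ⟨k, hRk⟩
  have hcD : Commute R (L - R) := (hc.sub_left (Commute.refl R)).symm
  have key : IsNilpotent.exp L = IsNilpotent.exp R * IsNilpotent.exp (L - R) := by
    rw [← IsNilpotent.exp_add_of_commute hcD ⟨k, hRk⟩ hD, add_sub_cancel]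
  have hLe : ∀ z, IsNilpotent.exp L z = IsNilpotent.exp (r x) * z := fun z => by
    rw [IsNilpotent.exp_eq_sum hLk, IsNilpotent.exp_eq_sum hk]
    simp [hL, LinearMap.pow_mulLeft, Finset.sum_mul]
  have hRe : ∀ z, IsNilpotent.exp R z = z * IsNilpotent.exp (r x) := fun z => by
    rw [IsNilpotent.exp_eq_sum hRk, IsNilpotent.exp_eq_sum hk]
    simp [hR, LinearMap.pow_mulRight, Finset.mul_sum]
  have hmem : IsNilpotent.exp (L - R) (r Z) ∈ LinearMap.range r := by
    obtain ⟨m, hm⟩ := hD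
    rw [IsNilpotent.exp_eq_sum hm, LinearMap.sum_apply]
    refine Submodule.sum_mem _ fun i hi => ?_
    clear hi
    rw [LinearMap.smul_apply]
    refine rat_smul_mem _ _ ?_
    induction i with
    | zero => exact ⟨Z, rfl⟩
    | succ i ih =>
      obtain ⟨W, hW⟩ := ih
      refine ⟨⁅x, W⁆, ?_⟩
      rw [hr, hW, pow_succ']
      rfl
  obtain ⟨Z', hZ'⟩ := hmem
  exact ⟨Z', by rw [← hLe, key, Module.End.mul_apply, hRe, hZ']⟩

theorem exp_apply_mem {W : Type*} [AddCommGroup W] [Module ℂ W] [Module ℚ (Module.End ℂ W)]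
    (N : Submodule ℂ W) (a : Module.End ℂ W) (ha : ∀ v ∈ N, a v ∈ N) {v : W} (hv : v ∈ N) :
    IsNilpotent.exp a v ∈ N := by
  let S : Submodule ℂ (Module.End ℂ W) :=
    { carrier := {b | ∀ v ∈ N, b v ∈ N}
      add_mem' := fun h h' v hv => N.add_mem (h v hv) (h' v hv)
      zero_mem' := fun v _ => N.zero_mem
      smul_mem' := fun c b h v hv => N.smul_mem _ (h v hv) }
  have : IsNilpotent.exp a ∈ S := by
    refine Submodule.sum_mem _ fun i hi => rat_smul_mem _ _ ?_
    clear hi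
    induction i with
    | zero => exact fun v hv => hv
    | succ i ih => exact fun v hv => by rw [pow_succ']; exact ha _ (ih v hv)
  exact this v hv

end Exponential

/-! ### The matrix `ω` and the operator `ω_ρ` treated together -/

section

variable {n : ℕ} {g : LieSubalgebra ℝ (Matrix (Fin n) (Fin n) ℝ)}
  {c : LieSubalgebra ℝ g} {P : Set (Module.Dual ℂ (cartanC c))}

theorem SimpleTriple.isNilpotent_X {A : Type*} [Ring A] [Algebra ℂ A] [FiniteDimensional ℂ A]
    (r : complexify g →ₗ[ℂ] A) (hr : ∀ x y, r ⁅x, y⁆ = r x * r y - r y * r x)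
    (t : SimpleTriple P) : IsNilpotent (r t.X) :=
  isNilpotent_of_commutator_eq (h := r t.H) (by
    rw [← hr, t.isSl2Triple.lie_h_e_nsmul, map_nsmul])

theorem SimpleTriple.isNilpotent_Y {A : Type*} [Ring A] [Algebra ℂ A] [FiniteDimensional ℂ A]
    (r : complexify g →ₗ[ℂ] A) (hr : ∀ x y, r ⁅x, y⁆ = r x * r y - r y * r x)
    (t : SimpleTriple P) : IsNilpotent (r t.Y) :=
  isNilpotent_of_commutator_eq (h := r (-(t.H : complexify g))) (by
    rw [← hr, t.isSl2Triple.symm.lie_h_e_nsmul, map_nsmul])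

/-- The product of the Weyl group representatives in a representation `r`. -/
def weylProduct {A : Type*} [Ring A] [Module ℚ A] (r : complexify g → A)
    (l : List (SimpleTriple P)) : A :=
  (l.map fun t => weylFactor (r t.X) (r t.Y)).prod

theorem isUnit_weylProduct {A : Type*} [Ring A] [Algebra ℂ A] [FiniteDimensional ℂ A]
    [Algebra ℚ A] (r : complexify g →ₗ[ℂ] A) (hr : ∀ x y, r ⁅x, y⁆ = r x * r y - r y * r x)
    (l : List (SimpleTriple P)) : IsUnit (weylProduct r l) := by
  induction l with
  | nil => exact isUnit_one
  | cons t l ih =>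
    have hX := IsNilpotent.isUnit_exp (t.isNilpotent_X r hr)
    have hY := IsNilpotent.isUnit_exp (t.isNilpotent_Y r hr).neg
    have := ((hX.mul hY).mul hX).mul ih
    simpa [weylProduct, weylFactor] using this

theorem exists_weylProduct_mul {A : Type*} [Ring A] [Algebra ℂ A] [FiniteDimensional ℂ A]
    [Algebra ℚ A] (r : complexify g →ₗ[ℂ] A) (hr : ∀ x y, r ⁅x, y⁆ = r x * r y - r y * r x)
    (l : List (SimpleTriple P)) (Z : complexify g) :
    ∃ Z', weylProduct r l * r Z = r Z' * weylProduct r l := by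
  induction l with
  | nil => exact ⟨Z, by simp [weylProduct]⟩
  | cons t l ih =>
    obtain ⟨Z₀, h₀⟩ := ih
    have hX := t.isNilpotent_X r hr
    obtain ⟨Z₁, h₁⟩ := exists_exp_mul r hr t.X hX Z₀
    obtain ⟨Z₂, h₂⟩ := exists_exp_mul r hr (-t.Y) (by
      rw [map_neg]; exact (t.isNilpotent_Y r hr).neg) Z₁
    obtain ⟨Z₃, h₃⟩ := exists_exp_mul r hr t.X hX Z₂
    rw [map_neg] at h₂
    refine ⟨Z₃, ?_⟩
    have hcons : weylProduct r (t :: l) = IsNilpotent.exp (r t.X) * IsNilpotent.exp (-r t.Y) *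
        IsNilpotent.exp (r t.X) * weylProduct r l := by simp [weylProduct, weylFactor]
    rw [hcons, mul_assoc _ (weylProduct r l), h₀, ← mul_assoc, mul_assoc _ _ (r Z₀), h₁,
      ← mul_assoc, mul_assoc _ _ (r Z₁), h₂, ← mul_assoc, h₃]
    simp only [mul_assoc]

/-- Nilpotency of the root vectors is what allows `φ` to be moved inside `IsNilpotent.exp`. -/
theorem map_weylProduct {A B : Type*} [Ring A] [Algebra ℂ A] [FiniteDimensional ℂ A]
    [Algebra ℚ A] [Ring B] [Module ℚ B] (φ : A →+* B) (r : complexify g →ₗ[ℂ] A)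
    (hr : ∀ x y, r ⁅x, y⁆ = r x * r y - r y * r x) (l : List (SimpleTriple P)) :
    φ (weylProduct r l) = weylProduct (fun Z => φ (r Z)) l := by
  rw [weylProduct, map_list_prod, List.map_map, weylProduct]
  congr 1
  refine List.map_congr_left fun t _ => ?_
  have hX := t.isNilpotent_X r hr
  have hY := (t.isNilpotent_Y r hr).neg
  simp only [Function.comp_apply, weylFactor, map_mul, IsNilpotent.map_exp hX,
    IsNilpotent.map_exp hY, map_neg]

variable {V : Type*} [AddCommGroup V] [Module ℝ V]

/-- The standard representation of the complexification next to the complexification of `ρ`. -/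
def pairRep (ρ : g →ₗ⁅ℝ⁆ Module.End ℝ V) :
    complexify g →ₗ[ℂ] Matrix (Fin n) (Fin n) ℂ × Module.End ℂ (ℂ ⊗[ℝ] V) :=
  LinearMap.prod (complexify g).toSubmodule.subtype (rhoC ρ : complexify g →ₗ[ℂ] _)

theorem pairRep_lie (ρ : g →ₗ⁅ℝ⁆ Module.End ℝ V) (x y : complexify g) :
    pairRep ρ ⁅x, y⁆ = pairRep ρ x * pairRep ρ y - pairRep ρ y * pairRep ρ x :=
  Prod.ext rfl ((rhoC ρ).map_lie x y)

variable [FiniteDimensional ℝ V]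

theorem weylProduct_pairRep (ρ : g →ₗ⁅ℝ⁆ Module.End ℝ V) (l : List (SimpleTriple P)) :
    weylProduct (pairRep ρ) l = (omega l, omegaRho ρ l) :=
  Prod.ext
    (map_weylProduct (RingHom.fst (Matrix (Fin n) (Fin n) ℂ) (Module.End ℂ (ℂ ⊗[ℝ] V))) _
      (pairRep_lie ρ) l)
    (map_weylProduct (RingHom.snd (Matrix (Fin n) (Fin n) ℂ) (Module.End ℂ (ℂ ⊗[ℝ] V))) _
      (pairRep_lie ρ) l)

theorem isUnit_omega_omegaRho (ρ : g →ₗ⁅ℝ⁆ Module.End ℝ V) (l : List (SimpleTriple P)) :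
    IsUnit (omega l) ∧ IsUnit (omegaRho ρ l) := by
  have h := isUnit_weylProduct (pairRep ρ) (pairRep_lie ρ) l
  rw [weylProduct_pairRep, Prod.isUnit_iff] at h
  exact h

/-- Nothing here makes `ρ` a representation of a group, so conjugation by `ω` and by `ω_ρ` must be
compared directly. Working in the product ring of `pairRep` yields one `Z'` for both factors, even
though `ρ` may have a kernel. -/
theorem exists_omegaRho_mul (ρ : g →ₗ⁅ℝ⁆ Module.End ℝ V) (l : List (SimpleTriple P))
    (Z : complexify g) :
    ∃ Z' : complexify g, (Z' : Matrix (Fin n) (Fin n) ℂ) = omega l * Z * (omega l)⁻¹ ∧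
      omegaRho ρ l * rhoC ρ Z = rhoC ρ Z' * omegaRho ρ l := by
  obtain ⟨Z', h⟩ := exists_weylProduct_mul (pairRep ρ) (pairRep_lie ρ) l Z
  rw [weylProduct_pairRep] at h
  refine ⟨Z', ?_, congrArg Prod.snd h⟩
  have h1 : omega l * (Z : Matrix (Fin n) (Fin n) ℂ) = Z' * omega l := congrArg Prod.fst h
  rw [h1, mul_assoc, Matrix.mul_nonsing_inv _ ((Matrix.isUnit_iff_isUnit_det _).1
    (isUnit_omega_omegaRho ρ l).1), mul_one]

end

/-! ### Conjugation and the invariant complement -/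

section

variable {n : ℕ} {g : LieSubalgebra ℝ (Matrix (Fin n) (Fin n) ℝ)}
  {c : LieSubalgebra ℝ g} {P : Set (Module.Dual ℂ (cartanC c))}
  {V : Type*} [AddCommGroup V] [Module ℝ V]

theorem vconj_smul (z : ℂ) (v : ℂ ⊗[ℝ] V) : vconj (z • v) = starRingEnd ℂ z • vconj v := by
  induction v using TensorProduct.induction_on with
  | zero => simp
  | tmul a v => simp [vconj, TensorProduct.smul_tmul']
  | add v w hv hw => rw [smul_add, map_add, hv, hw, map_add, smul_add]

theorem vconj_vconj (v : ℂ ⊗[ℝ] V) : vconj (vconj v) = v := by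
  induction v using TensorProduct.induction_on with
  | zero => simp
  | tmul a v => simp [vconj]
  | add v w hv hw => rw [map_add, map_add, hv, hw]

theorem vconj_baseChange (f : Module.End ℝ V) (v : ℂ ⊗[ℝ] V) :
    vconj (f.baseChange ℂ v) = f.baseChange ℂ (vconj v) := by
  induction v using TensorProduct.induction_on with
  | zero => simp
  | tmul a v => simp [vconj]
  | add v w hv hw => rw [map_add, map_add, hv, hw, map_add, map_add]

theorem rhoC_apply (ρ : g →ₗ⁅ℝ⁆ Module.End ℝ V) (Z : complexify g) (v : ℂ ⊗[ℝ] V) :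
    rhoC ρ Z v = (ρ (rePart Z)).baseChange ℂ v +
      Complex.I • (ρ (imPart Z)).baseChange ℂ v := rfl

theorem vconj_rhoC (ρ : g →ₗ⁅ℝ⁆ Module.End ℝ V) (Z : complexify g) (v : ℂ ⊗[ℝ] V) :
    vconj (rhoC ρ Z v) = rhoC ρ (conj Z) (vconj v) := by
  rw [rhoC_apply, rhoC_apply, map_add, vconj_smul, vconj_baseChange, vconj_baseChange,
    rePart_conj, imPart_conj, map_neg, LinearMap.baseChange_neg, Complex.conj_I,
    LinearMap.neg_apply, smul_neg, neg_smul]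

theorem conj_conj (Z : complexify g) : conj (conj Z) = Z := by
  ext; simp [conj]

/-- `𝔤` acting on the real vector space underlying `ℂ ⊗ V`. -/
def realRep (ρ : g →ₗ⁅ℝ⁆ Module.End ℝ V) : g →ₗ⁅ℝ⁆ Module.End ℝ (ℂ ⊗[ℝ] V) where
  toFun X := (ρ X).lTensor ℂ
  map_add' X Y := by rw [map_add, LinearMap.lTensor_add]
  map_smul' r X := by rw [map_smul, LinearMap.lTensor_smul, RingHom.id_apply]
  map_lie' {X Y} := by
    simp only [LieHom.map_lie, LieRing.of_associative_ring_bracket, LinearMap.lTensor_sub,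
      LinearMap.lTensor_mul]

theorem rhoC_eq_realRep (ρ : g →ₗ⁅ℝ⁆ Module.End ℝ V) (Z : complexify g) (v : ℂ ⊗[ℝ] V) :
    rhoC ρ Z v = realRep ρ (rePart Z) v + Complex.I • realRep ρ (imPart Z) v := rfl

theorem realRep_eq_rhoC (ρ : g →ₗ⁅ℝ⁆ Module.End ℝ V) (X : g) (v : ℂ ⊗[ℝ] V) :
    realRep ρ X v = rhoC ρ (ofReal X) v := by
  have h1 : rePart (ofReal X) = X := by ext; simp [rePart, ofReal]
  have h2 : imPart (ofReal X) = 0 := by ext; simp [imPart, ofReal]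
  rw [rhoC_eq_realRep, h1, h2, map_zero, LinearMap.zero_apply, smul_zero, add_zero]

/-- The complex linear part of a real linear map. -/
def complexLinearPart {W : Type*} [AddCommGroup W] [Module ℂ W] [Module ℝ W]
    [IsScalarTower ℝ ℂ W] (p : Module.End ℝ W) :
    Module.End ℂ W where
  toFun v := (2⁻¹ : ℂ) • (p v - Complex.I • p (Complex.I • v))
  map_add' v w := by simp only [smul_add, map_add]; module
  map_smul' z v := by
    have h : ∀ w : W, z • w = z.re • w + z.im • Complex.I • w := fun w => by
      conv_lhs => rw [← Complex.re_add_im z, add_smul, mul_smul]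
      exact congrArg₂ (· + ·) (algebraMap_smul ℂ z.re w) (algebraMap_smul ℂ z.im (Complex.I • w))
    have hcomm : ∀ (a : ℝ) (w : W), Complex.I • a • w = a • Complex.I • w := fun a w => by
      rw [← algebraMap_smul ℂ a w, smul_comm, algebraMap_smul]
    have h1 : p (z • v) = z.re • p v + z.im • p (Complex.I • v) := by
      rw [h, map_add, p.map_smul z.re, p.map_smul z.im]
    have h2 : p (Complex.I • z • v) = z.re • p (Complex.I • v) - z.im • p v := by
      have hI : Complex.I • z • v = z.re • Complex.I • v - z.im • v := by
        rw [h v, smul_add, hcomm, hcomm,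
          smul_smul Complex.I Complex.I, Complex.I_mul_I, neg_one_smul, smul_neg, sub_eq_add_neg]
      rw [hI, map_sub, p.map_smul z.re, p.map_smul z.im]
    rw [h1, h2, RingHom.id_apply, smul_comm z, smul_sub z, h (p v), h (Complex.I • p _),
      smul_smul Complex.I Complex.I, Complex.I_mul_I, smul_sub Complex.I, hcomm,
      hcomm]
    module

theorem complexLinearPart_apply {W : Type*} [AddCommGroup W] [Module ℂ W] [Module ℝ W]
    [IsScalarTower ℝ ℂ W] (p : Module.End ℝ W)
    (v : W) :
    complexLinearPart p v = (2⁻¹ : ℂ) • (p v - Complex.I • p (Complex.I • v)) := rfl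

/-- The part of an endomorphism of `ℂ ⊗ V` that commutes with conjugation. -/
def realPart (p : Module.End ℂ (ℂ ⊗[ℝ] V)) : Module.End ℂ (ℂ ⊗[ℝ] V) where
  toFun v := (2⁻¹ : ℂ) • (p v + vconj (p (vconj v)))
  map_add' v w := by simp only [map_add]; module
  map_smul' z v := by
    rw [vconj_smul, map_smul, map_smul, vconj_smul, Complex.conj_conj, ← smul_add, smul_comm,
      RingHom.id_apply]

theorem realPart_apply (p : Module.End ℂ (ℂ ⊗[ℝ] V)) (v : ℂ ⊗[ℝ] V) :
    realPart p v = (2⁻¹ : ℂ) • (p v + vconj (p (vconj v))) := rfl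

theorem realPart_vconj (p : Module.End ℂ (ℂ ⊗[ℝ] V)) (v : ℂ ⊗[ℝ] V) :
    realPart p (vconj v) = vconj (realPart p v) := by
  rw [realPart_apply, realPart_apply, vconj_smul, map_add, vconj_vconj, vconj_vconj,
    add_comm, map_inv₀, Complex.conj_ofNat]

/-- Both averagings keep the values in `M`, the identity on `M` and equivariance, because `M` is
stable under `i` and under conjugation. The first restores complex linearity, and with it
equivariance under the complexified algebra; the second makes the kernel conjugation invariant. -/
theorem exists_invariant_complement [FiniteDimensional ℝ V] [LieAlgebra.IsSemisimple ℝ g]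
    (ρ : g →ₗ⁅ℝ⁆ Module.End ℝ V) (M : Submodule ℂ (ℂ ⊗[ℝ] V)) (hM : IsInvariant ρ M)
    (hMconj : IsConjInvariant M) :
    ∃ N : Submodule ℂ (ℂ ⊗[ℝ] V), IsInvariant ρ N ∧ IsConjInvariant N ∧ IsCompl M N := by
  obtain ⟨p, hpM, hp1, hpc⟩ : ∃ p : Module.End ℝ (ℂ ⊗[ℝ] V), (∀ m, p m ∈ M) ∧
      (∀ m ∈ M, p m = m) ∧ ∀ X m, p (realRep ρ X m) = realRep ρ X (p m) :=
    exists_equivariant_projection (realRep ρ) (M.restrictScalars ℝ)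
      (fun X m hm => by rw [realRep_eq_rhoC]; exact hM _ m hm)
  set p₁ : Module.End ℂ (ℂ ⊗[ℝ] V) := complexLinearPart p with hp₁
  have h₁M : ∀ v, p₁ v ∈ M := fun v =>
    M.smul_mem _ (M.sub_mem (hpM _) (M.smul_mem _ (hpM _)))
  have half : ∀ w : ℂ ⊗[ℝ] V, (2⁻¹ : ℂ) • (w + w) = w := fun w => by
    rw [← two_smul ℂ w, smul_smul]; norm_num
  have h₁id : ∀ v ∈ M, p₁ v = v := fun v hv => by
    rw [hp₁, complexLinearPart_apply, hp1 v hv, hp1 _ (M.smul_mem _ hv), smul_smul,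
      Complex.I_mul_I, neg_one_smul, sub_neg_eq_add, half]
  have h₁r : ∀ X v, p₁ (realRep ρ X v) = realRep ρ X (p₁ v) := fun X v => by
    have hs : ∀ (z : ℂ) (w : ℂ ⊗[ℝ] V), realRep ρ X (z • w) = z • realRep ρ X w := fun z w => by
      rw [realRep_eq_rhoC, realRep_eq_rhoC, map_smul]
    rw [hp₁, complexLinearPart_apply, complexLinearPart_apply, hs, map_sub, hs, ← hpc, ← hpc, hs]
  have h₁c : ∀ Z v, p₁ (rhoC ρ Z v) = rhoC ρ Z (p₁ v) := fun Z v => by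
    rw [rhoC_eq_realRep, rhoC_eq_realRep, map_add, map_smul, h₁r, h₁r]
  have hqM : ∀ v, realPart p₁ v ∈ M := fun v =>
    M.smul_mem _ (M.add_mem (h₁M _) (hMconj _ (h₁M _)))
  have hqid : ∀ v ∈ M, realPart p₁ v = v := fun v hv => by
    rw [realPart_apply, h₁id v hv, h₁id _ (hMconj v hv), vconj_vconj, half]
  have hqc : ∀ Z v, realPart p₁ (rhoC ρ Z v) = rhoC ρ Z (realPart p₁ v) := fun Z v => by
    rw [realPart_apply, realPart_apply, vconj_rhoC, h₁c, h₁c, vconj_rhoC, conj_conj, map_smul,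
      map_add]
  refine ⟨LinearMap.ker (realPart p₁), fun Z v hv => ?_, fun v hv => ?_, ?_⟩
  · rw [LinearMap.mem_ker] at hv ⊢
    rw [hqc, hv, map_zero]
  · rw [LinearMap.mem_ker] at hv ⊢
    rw [realPart_vconj, hv, map_zero]
  · rw [isCompl_iff, Submodule.disjoint_def, codisjoint_iff_le_sup]
    refine ⟨fun v hv hv' => ?_, fun v _ => ?_⟩
    · rw [← hqid v hv]; exact hv'
    · rw [← add_sub_cancel (realPart p₁ v) v]
      refine Submodule.add_mem_sup (hqM v) ?_
      rw [LinearMap.mem_ker, map_sub, hqid _ (hqM v), sub_self]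

/-! ### Isotypical components and the map `v ↦ ω_ρ⁻¹ v̄` -/

theorem isInvariant_isotypical (ρ : g →ₗ⁅ℝ⁆ Module.End ℝ V) (μ : Module.Dual ℂ (cartanC c)) :
    IsInvariant ρ (isotypical P ρ μ) := fun Z v hv => by
  rw [isotypical, Submodule.mem_sInf] at hv ⊢
  exact fun N hN => hN.1 Z v (hv N hN)

theorem IsHighWeightVector.mem_isotypical {ρ : g →ₗ⁅ℝ⁆ Module.End ℝ V}
    {μ : Module.Dual ℂ (cartanC c)} {v : ℂ ⊗[ℝ] V} (hv : IsHighWeightVector P ρ μ v) :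
    v ∈ isotypical P ρ μ :=
  Submodule.mem_sInf.2 fun _ hN => hN.2 v hv

theorem omegaRho_apply_mem {ρ : g →ₗ⁅ℝ⁆ Module.End ℝ V} (l : List (SimpleTriple P))
    {N : Submodule ℂ (ℂ ⊗[ℝ] V)} (hN : IsInvariant ρ N) {v : ℂ ⊗[ℝ] V} (hv : v ∈ N) :
    omegaRho ρ l v ∈ N := by
  induction l with
  | nil => exact hv
  | cons t l ih =>
    have hX : ∀ w ∈ N, IsNilpotent.exp (rhoC ρ t.X) w ∈ N := fun w hw =>
      exp_apply_mem N _ (hN t.X) hw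
    have hY : ∀ w ∈ N, IsNilpotent.exp (-rhoC ρ t.Y) w ∈ N := fun w hw =>
      exp_apply_mem N _ (fun u hu => N.neg_mem (hN t.Y u hu)) hw
    exact hX _ (hY _ (hX _ ih))

variable [FiniteDimensional ℝ V]

theorem omegaRho_twistedConj (ρ : g →ₗ⁅ℝ⁆ Module.End ℝ V) (l : List (SimpleTriple P))
    (v : ℂ ⊗[ℝ] V) : omegaRho ρ l (twistedConj ρ l v) = vconj v := by
  rw [twistedConj, ← Module.End.mul_apply,
    Ring.mul_inverse_cancel _ (isUnit_omega_omegaRho ρ l).2, Module.End.one_apply]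

theorem omegaRho_injective (ρ : g →ₗ⁅ℝ⁆ Module.End ℝ V) (l : List (SimpleTriple P)) :
    Function.Injective (omegaRho ρ l) :=
  ((Module.End.isUnit_iff _).1 (isUnit_omega_omegaRho ρ l).2).injective

/-- Since `ω_ρ` is injective and maps the finite-dimensional `N` into itself, it is onto `N`, so its
inverse preserves `N` too. -/
theorem twistedConj_mem {ρ : g →ₗ⁅ℝ⁆ Module.End ℝ V} (l : List (SimpleTriple P))
    {N : Submodule ℂ (ℂ ⊗[ℝ] V)} (hN : IsInvariant ρ N) (hNconj : IsConjInvariant N)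
    {v : ℂ ⊗[ℝ] V} (hv : v ∈ N) : twistedConj ρ l v ∈ N := by
  have hinj : Function.Injective
      ((omegaRho ρ l).restrict (p := N) (q := N) fun _ => omegaRho_apply_mem l hN) :=
    fun a b hab => Subtype.ext (omegaRho_injective ρ l (congrArg Subtype.val hab))
  obtain ⟨u, hu⟩ := LinearMap.injective_iff_surjective.1 hinj ⟨vconj v, hNconj v hv⟩
  have hu' : omegaRho ρ l u = vconj v := congrArg Subtype.val hu
  rw [omegaRho_injective ρ l ((omegaRho_twistedConj ρ l v).trans hu'.symm)]
  exact u.2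

/-- The vector `v̄` is annihilated by `σ(𝔶)` and has weight `λ^σ`. Passing `ω_ρ` across the action
turns `𝔶` into `ω𝔶ω⁻¹ = σ(𝔶)` and `H` into `ωHω⁻¹`. -/
theorem IsHighWeightVector.twistedConj {ρ : g →ₗ⁅ℝ⁆ Module.End ℝ V} {l : List (SimpleTriple P)}
    (hl : ConjugatesNilradical l) {μ : Module.Dual ℂ (cartanC c)} {v : ℂ ⊗[ℝ] V}
    (hv : IsHighWeightVector P ρ μ v) :
    IsHighWeightVector P ρ (theta l μ) (twistedConj ρ l v) := by
  have hkey : ∀ Z Z' : complexify g, omegaRho ρ l * rhoC ρ Z = rhoC ρ Z' * omegaRho ρ l →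
      omegaRho ρ l (rhoC ρ Z (RealRep.twistedConj ρ l v)) = vconj (rhoC ρ (conj Z') v) := by
    intro Z Z' h
    rw [← Module.End.mul_apply, h, Module.End.mul_apply, omegaRho_twistedConj, vconj_rhoC,
      conj_conj]
  refine ⟨fun h => hv.ne_zero ?_, fun Z hZ => ?_, fun H => ?_⟩
  · have h1 := omegaRho_twistedConj ρ l v
    rw [h, map_zero] at h1
    rw [← vconj_vconj v, ← h1, map_zero]
  · obtain ⟨Z', hZ', h⟩ := exists_omegaRho_mul ρ l Z
    -- Only the inclusion of `ω𝔶ω⁻¹` in `σ(𝔶)` is needed.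
    have hmem : (Z' : Matrix (Fin n) (Fin n) ℂ) ∈
        {A | ∃ Z ∈ nilradical P, A = (conj Z : Matrix (Fin n) (Fin n) ℂ)} := by
      rw [← show _ = _ from hl]
      exact ⟨Z, hZ, hZ'⟩
    obtain ⟨Z₀, hZ₀, h₀⟩ := hmem
    have h₁ : Z' = conj Z₀ := Subtype.ext h₀
    apply omegaRho_injective ρ l
    rw [hkey Z Z' h, h₁, conj_conj, hv.nilradical_apply Z₀ hZ₀, map_zero, map_zero]
  · obtain ⟨Z', hZ', h⟩ := exists_omegaRho_mul ρ l H
    have h₁ : Z' = (omegaConj l H : cartanC c) := Subtype.ext hZ'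
    have h₂ : conj Z' = (cartanConj (omegaConj l H) : cartanC c) := by rw [h₁]; rfl
    apply omegaRho_injective ρ l
    rw [hkey H Z' h, h₂, hv.cartan_apply, vconj_smul, map_smul, omegaRho_twistedConj]
    rfl

/-- The vectors whose conjugate lies in the component form an invariant subspace. It contains each
generator `v`, because `v̄ = ω_ρ(ω_ρ⁻¹ v̄)` and `ω_ρ⁻¹ v̄` is again a generator; minimality of the
component concludes. -/
theorem isConjInvariant_isotypical {ρ : g →ₗ⁅ℝ⁆ Module.End ℝ V} {l : List (SimpleTriple P)}
    (hl : ConjugatesNilradical l) {μ : Module.Dual ℂ (cartanC c)} (hμ : μ = theta l μ) :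
    IsConjInvariant (isotypical P ρ μ) := by
  let S : Submodule ℂ (ℂ ⊗[ℝ] V) :=
    { carrier := {v | vconj v ∈ isotypical P ρ μ}
      add_mem' := fun {a b} ha hb => by
        change vconj (a + b) ∈ isotypical P ρ μ
        rw [map_add]; exact Submodule.add_mem _ ha hb
      zero_mem' := by
        change vconj 0 ∈ isotypical P ρ μ
        rw [map_zero]; exact Submodule.zero_mem _
      smul_mem' := fun z a ha => by
        change vconj (z • a) ∈ isotypical P ρ μ
        rw [vconj_smul]; exact Submodule.smul_mem _ _ ha }
  have hS : isotypical P ρ μ ≤ S := by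
    refine sInf_le ⟨fun Z v hv => ?_, fun v hv => ?_⟩
    · change vconj (rhoC ρ Z v) ∈ isotypical P ρ μ
      rw [vconj_rhoC]
      exact isInvariant_isotypical ρ μ _ _ hv
    · change vconj v ∈ isotypical P ρ μ
      rw [← omegaRho_twistedConj ρ l v]
      have := hv.twistedConj hl
      rw [← hμ] at this
      exact omegaRho_apply_mem l (isInvariant_isotypical ρ μ) this.mem_isotypical
  exact fun v hv => hS hv

omit [FiniteDimensional ℝ V] in
-- High weight vectors generate the component, so one of them lies outside `M`. Its `N`-part along
-- `M` is nonzero, and it inherits the defining equations since both summands are invariant.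
theorem exists_isHighWeightVector_mem {ρ : g →ₗ⁅ℝ⁆ Module.End ℝ V}
    {μ : Module.Dual ℂ (cartanC c)} {M N : Submodule ℂ (ℂ ⊗[ℝ] V)} (hM : IsInvariant ρ M)
    (hN : IsInvariant ρ N) (hMN : Disjoint M N) (hsup : M ⊔ N = isotypical P ρ μ)
    (hlt : M < isotypical P ρ μ) : ∃ v ∈ N, IsHighWeightVector P ρ μ v := by
  obtain ⟨v, hv, hvM⟩ : ∃ v, IsHighWeightVector P ρ μ v ∧ v ∉ M := by
    by_contra! h
    exact hlt.not_ge (sInf_le ⟨hM, h⟩)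
  obtain ⟨m, hm, u, hu, rfl⟩ := Submodule.mem_sup.1 (hsup ▸ hv.mem_isotypical)
  have hzero : ∀ a ∈ M, ∀ b ∈ N, a + b = 0 → b = 0 := fun a ha b hb hab => by
    refine Submodule.disjoint_def.1 hMN b ?_ hb
    rw [← neg_eq_of_add_eq_zero_right hab]
    exact M.neg_mem ha
  refine ⟨u, hu, fun h => hvM ?_, fun Z hZ => ?_, fun H => ?_⟩
  · rw [h, add_zero]; exact hm
  · refine hzero _ (hM Z m hm) _ (hN Z u hu) ?_
    rw [← map_add]; exact hv.nilradical_apply Z hZ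
  · refine sub_eq_zero.1 (hzero _ (M.sub_mem (hM H m hm) (M.smul_mem (μ H) hm)) _
      (N.sub_mem (hN H u hu) (N.smul_mem (μ H) hu)) ?_)
    have := hv.cartan_apply H
    rw [map_add, smul_add] at this
    rw [sub_add_sub_comm, this, sub_self]

end

end RealRep

end

/-! ### The complement and the dichotomy for `v` and `ω_ρ⁻¹ v̄` -/

theorem lemma4p9 {n : ℕ} (g : LieSubalgebra ℝ (Matrix (Fin n) (Fin n) ℝ))
    [LieAlgebra.IsSemisimple ℝ g]
    (c : LieSubalgebra ℝ g) (hc : RealRep.IsCartan c)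
    (P : Set (Module.Dual ℂ (RealRep.cartanC c))) (hP : RealRep.IsPositiveSystem c P)
    {V : Type*} [AddCommGroup V] [Module ℝ V] [FiniteDimensional ℝ V]
    (ρ : g →ₗ⁅ℝ⁆ Module.End ℝ V)
    (l : List (RealRep.SimpleTriple P)) (hl : RealRep.ConjugatesNilradical l)
    (lam : Module.Dual ℂ (RealRep.cartanC c)) (hlam : lam = RealRep.theta l lam)
    (M : Submodule ℂ (ℂ ⊗[ℝ] V)) (hM : RealRep.IsInvariant ρ M)
    (hMconj : RealRep.IsConjInvariant M) (hMlt : M < RealRep.isotypical P ρ lam) :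
    (∃ N : Submodule ℂ (ℂ ⊗[ℝ] V), RealRep.IsInvariant ρ N ∧ RealRep.IsConjInvariant N ∧
      M ⊓ N = ⊥ ∧ M ⊔ N = RealRep.isotypical P ρ lam) ∧
    ∀ (d : ℕ) (w : Fin d → ℂ ⊗[ℝ] V), RealRep.IsHighWeightBasis P ρ M w →
      ∃ v : ℂ ⊗[ℝ] V, RealRep.IsHighWeightVector P ρ lam v ∧
        ((ExteriorAlgebra.ιMulti ℂ d w * ExteriorAlgebra.ι ℂ v ≠ 0 ∧
            ExteriorAlgebra.ι ℂ v * ExteriorAlgebra.ι ℂ (RealRep.twistedConj ρ l v) = 0) ∨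
          (ExteriorAlgebra.ι ℂ v * ExteriorAlgebra.ι ℂ (RealRep.twistedConj ρ l v) ≠ 0 ∧
            ExteriorAlgebra.ιMulti ℂ d w * ExteriorAlgebra.ι ℂ v *
              ExteriorAlgebra.ι ℂ (RealRep.twistedConj ρ l v) ≠ 0)) := by
  have hI := RealRep.isInvariant_isotypical (P := P) ρ lam
  have hIc := RealRep.isConjInvariant_isotypical (ρ := ρ) hl hlam
  obtain ⟨N₀, hN₀, hN₀c, hcompl⟩ := RealRep.exists_invariant_complement ρ M hM hMconj
  set N := N₀ ⊓ RealRep.isotypical P ρ lam with hNdef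
  have hN : RealRep.IsInvariant ρ N := fun Z v hv => ⟨hN₀ Z v hv.1, hI Z v hv.2⟩
  have hNc : RealRep.IsConjInvariant N := fun v hv => ⟨hN₀c v hv.1, hIc v hv.2⟩
  have hdisj : Disjoint M N := hcompl.disjoint.mono_right inf_le_left
  have hsup : M ⊔ N = RealRep.isotypical P ρ lam := by
    -- Modular law: `M` lies in the component, so cutting `N₀` down to the component keeps it a
    -- complement there.
    rw [hNdef, ← sup_inf_assoc_of_le _ hMlt.le, hcompl.sup_eq_top, top_inf_eq]
  refine ⟨⟨N, hN, hNc, hdisj.eq_bot, hsup⟩, fun d w hw => ?_⟩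
  obtain ⟨v, hvN, hv⟩ := RealRep.exists_isHighWeightVector_mem hM hN hdisj hsup hMlt
  have hspan : Submodule.span ℂ (Set.range w) ≤ M :=
    Submodule.span_le.2 (Set.range_subset_iff.2 hw.mem)
  have hvspan : v ∉ Submodule.span ℂ (Set.range w) := fun h =>
    hv.ne_zero (Submodule.disjoint_def.1 hdisj v (hspan h) hvN)
  set u := RealRep.twistedConj ρ l v with hu
  have huN : u ∈ N := RealRep.twistedConj_mem l hN hNc hvN
  refine ⟨v, hv, ?_⟩
  by_cases hdep : ∃ a : ℂ, u = a • v
  · obtain ⟨a, ha⟩ := hdep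
    refine Or.inl ⟨RealRep.ιMulti_mul_ι_ne_zero hw.linearIndependent hvspan, ?_⟩
    rw [← hu, ha, map_smul, mul_smul_comm, ExteriorAlgebra.ι_sq_zero, smul_zero]
  · refine Or.inr ⟨?_, RealRep.ιMulti_mul_ι_mul_ι_ne_zero hw.linearIndependent hvspan ?_⟩
    -- The empty family gives `v ∧ u ≠ 0`.
    · have h := RealRep.ιMulti_mul_ι_mul_ι_ne_zero (K := ℂ) (w := (![] : Fin 0 → ℂ ⊗[ℝ] V))
        (linearIndependent_empty_type) (v := v) (u := u) (by simpa using hv.ne_zero) (by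
          simp only [Set.range_eq_empty, insert_empty_eq, Submodule.mem_span_singleton]
          rintro ⟨a, ha⟩
          exact hdep ⟨a, ha.symm⟩)
      rwa [ExteriorAlgebra.ιMulti_zero_apply, one_mul] at h
    · intro h
      -- The component `z` lies in `M` as a combination of the `w_j` and in `N` as `u - a • v`, so
      -- it vanishes and `u` would be proportional to `v`.
      obtain ⟨a, z, hz, (huz : u = a • v + z)⟩ := Submodule.mem_span_insert.1 h
      have hzN : z ∈ N := by
        rw [show z = u - a • v by rw [huz, add_sub_cancel_left]]
        exact N.sub_mem huN (N.smul_mem a hvN)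
      rw [Submodule.disjoint_def.1 hdisj z (hspan hz) hzN, add_zero] at huz
      exact hdep ⟨a, huz⟩
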